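/- **Machine.** Values $v_\ell$ carry a label $\ell$ from a lattice $\mathcal L$ with least element $\mathsf{public}$; an operand is a register or a labelled value, and operations label their result with the join of the labels of their operands. A configuration $C=(\rho,\mu,n,\mathit{buf},\sigma)$ consists of a register map $\rho$, a memory $\mu$ (instructions at program points, which are never overwritten, and labelled data at data addresses), the current program point $n$, a reorder buffer $\mathit{buf}$ and a return stack buffer $\sigma$ (finite partial maps on $\mathbb N$). $C$ is *initial* (equivalently *terminal*) if $\mathit{buf}=\emptyset$. Instructions are: operations, conditional branches, loads, stores, indirect jumps, direct calls, returns (calls and returns keep the return addresses on a stack in memory, through a stack pointer register; a return uses a dedicated temporary register), and speculation fences. A step $C\hookrightarrow_d^{o}C'$ is chosen by an attacker directive $d$ and emits a list $o$ of observations: * *fetch*, possibly with a guessed branch outcome or jump target, appends the transient form of the instruction at $n$ to $\mathit{buf}$ (a call: a marker, the unresolved stack pointer update, the store of the public return address; a return: a marker, the load of the return address, the stack pointer update, an indirect jump to the top of $\sigma$ or, if there is none, to a guessed target), updates $\sigma$ for calls and returns, and moves $n$ to the next or predicted program point; * *execute $i$* resolves the entry at index $i$, in any order, provided that no fence is pending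 before $i$; registers are read from the latest earlier assignment in $\mathit{buf}$, or else from $\rho$. Branches and indirect jumps emit $\mathsf{jump}\ n_\ell$ ($\ell$ the join of the operand labels); after a wrong guess the younger entries are removed (rollback). A load takes its value from the latest earlier store in $\mathit{buf}$ resolved to the same address (emitting $\mathsf{fwd}\ a_{\ell}$) or, if there is none, from memory (emitting $\mathsf{read}\ a_{\ell}$), where $\ell$ is the join of the labels of the address operands; it may also, on a guess, first be forwarded the value of an arbitrary earlier store, which is checked when its address is resolved. Store values and store addresses are resolved separately, the latter emitting $\mathsf{fwd}\ a_{\ell}$. When a load turns out to have used a value from the wrong place, the instruction of the load and everything younger is removed and fetched again (rollback); * *retire* removes the oldest, fully resolved instruction from $\mathit{buf}$ (calls and returns as a whole) and commits it to $\rho$ and $\mu$; stores and calls emit $\mathsf{write}\ a_{\ell}$. Rollbacks also emit the unlabelled observation $\mathsf{rollback}$. Write $C\Downarrow^{N}_{D,O}C'$ if the sequence (schedule) $D$ of directives leads from $C$ to $C'$ with concatenated trace $O$ and contains exactly $N$ retire directives. Such an execution is *sequential* if $C$ is initial, $C'$ is terminal, and every fetched instruction is executed and retired before a further instruction is fetched.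 An observation *carries* the label $\ell$ if its address or jump target is labelled $\ell$. **Theorem (Label stability and secrecy).** Let $C$ be an initial configuration whose program does not use the dedicated temporary register of returns as an operand, and let $\ell\in\mathcal L$. Suppose that $C\Downarrow^{N}_{D_1,O_1}C_1$ and no observation in $O_1$ carries $\ell$. Then 1. there is a sequential execution $C\Downarrow^{N}_{D_2,O_2}C_2$ (with the same number $N$ of retired instructions) such that no observation in $O_2$ carries $\ell$; 2. for every sequential execution $C\Downarrow^{N'}_{D_2,O_2}C_2$ with $N'\le N$, no observation in $O_2$ carries $\ell$. In particular, for $\ell=\mathsf{secret}$: if a speculative execution of $C$ that retires $N$ instructions produces a trace without $\mathsf{secret}$ labels, then the sequential execution of $C$ up to $N$ retired instructions never produces a $\mathsf{secret}$ label. -/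

import Mathlib

namespace Spec

/-! ### Finite partial maps on `ℕ` (reorder buffer, return stack buffer) -/

/-- A partial map from `ℕ` to `T` with finite domain. -/
structure FMap (T : Type*) where
  get : ℕ → Option T
  finite : {i | get i ≠ none}.Finite

namespace FMap

variable {T : Type*}

/-- The empty mapping. -/
def empty : FMap T := ⟨fun _ => none, by simp⟩

/-- The domain. -/
noncomputable def dom (m : FMap T) : Finset ℕ := m.finite.toFinset

/-- `m[i ↦ t]`. -/
def set (m : FMap T) (i : ℕ) (t : T) : FMap T :=
  ⟨Function.update m.get i (some t), by
    refine (m.finite.union (Set.finite_singleton i)).subset ?_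
    intro j hj
    by_cases h : j = i
    · exact Or.inr h
    · left
      simpa [Function.update_of_ne h] using hj⟩

/-- The restriction of `m` to the indices satisfying `p`. -/
def restrict (m : FMap T) (p : ℕ → Prop) [DecidablePred p] : FMap T :=
  ⟨fun j => if p j then m.get j else none, by
    refine m.finite.subset ?_
    intro j hj
    by_cases h : p j
    · simpa [h] using hj
    · simp [h] at hj⟩

/-- `m[j : j < i]`. -/
def below (m : FMap T) (i : ℕ) : FMap T := m.restrict (fun j => j < i)

/-- `m[j : j > i]`. -/
def above (m : FMap T) (i : ℕ) : FMap T := m.restrict (fun j => i < j)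

/-- `m` with `i` removed from its domain. -/
def erase (m : FMap T) (i : ℕ) : FMap T := m.restrict (fun j => j ≠ i)

/-- The largest index in the domain, `0` for the empty map. -/
noncomputable def maxIdx (m : FMap T) : ℕ := m.dom.sup id

/-- The smallest index in the domain, `0` for the empty map. -/
noncomputable def minIdx (m : FMap T) : ℕ := sInf {i | m.get i ≠ none}

end FMap

/-! ### Values, instructions, directives, observations

`V` is the type of values (data, data addresses and program points), `L` the lattice of security
labels with least element `⊥` (the label `public`), `R` the type of register names and `Op` the
type of opcodes. -/

/-- A labelled value `v_ℓ`. -/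
@[ext]
structure LVal (V L : Type*) where
  val : V
  lab : L

/-- The join of the labels of a list of labelled values. -/
def joinLab {V L : Type*} [Lattice L] [OrderBot L] (vs : List (LVal V L)) : L :=
  (vs.map LVal.lab).foldr (· ⊔ ·) ⊥

/-- An operand is a register or a labelled value. -/
inductive Operand (R V L : Type*) where
  | reg (r : R)
  | val (v : LVal V L)

/-- Physical instructions. `next` is the following program point. -/
inductive Instr (R V L Op : Type*) where
  | op (o : Op) (r : R) (args : List (Operand R V L)) (next : V)
  | br (o : Op) (args : List (Operand R V L)) (nTrue nFalse : V)
  | load (r : R) (args : List (Operand R V L)) (next : V)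
  | store (src : Operand R V L) (args : List (Operand R V L)) (next : V)
  | jmpi (args : List (Operand R V L))
  | call (nf nret : V)
  | ret
  | fence (next : V)

/-- The operands that an instruction mentions explicitly. -/
def Instr.operands {R V L Op : Type*} : Instr R V L Op → List (Operand R V L)
  | .op _ _ args _ => args
  | .br _ args _ _ => args
  | .load _ args _ => args
  | .store src args _ => src :: args
  | .jmpi args => args
  | .call _ _ => []
  | .ret => []
  | .fence _ => []

/-- Transient instructions. -/
inductive Transient (R V L Op : Type*) where
  /-- unresolved operation -/
  | op (r : R) (o : Op) (args : List (Operand R V L))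
  /-- resolved operation `r = v_ℓ` -/
  | value (r : R) (v : LVal V L)
  /-- unresolved conditional, speculated to continue at `guess` -/
  | br (o : Op) (args : List (Operand R V L)) (guess nTrue nFalse : V)
  /-- resolved conditional or indirect jump -/
  | jump (n : V)
  /-- unresolved load, fetched at program point `pt` -/
  | load (r : R) (args : List (Operand R V L)) (pt : V)
  /-- partially resolved load: `v` has been forwarded from the store at index `j` by a guess -/
  | loadGuess (r : R) (args : List (Operand R V L)) (v : LVal V L) (j : ℕ) (pt : V)
  /-- resolved load `r = v_ℓ{dep, a}`; `dep = ⊥` if the value was read from memory -/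
  | loaded (r : R) (v : LVal V L) (dep : WithBot ℕ) (a : V) (pt : V)
  /-- store; the value is resolved if `src` is a value, the address if `dst` is in `Sum.inr` -/
  | store (src : Operand R V L) (dst : List (Operand R V L) ⊕ LVal V L)
  /-- unresolved indirect jump, predicted to go to `guess` -/
  | jmpi (args : List (Operand R V L)) (guess : V)
  /-- marker in front of the entries of a call -/
  | call
  /-- marker in front of the entries of a return -/
  | ret
  | fence

/-- The register that a transient instruction assigns, if any. -/
def Transient.target {R V L Op : Type*} : Transient R V L Op → Option R
  | .op r _ _ => some r
  | .value r _ => some r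
  | .load r _ _ => some r
  | .loadGuess r _ _ _ _ => some r
  | .loaded r _ _ _ _ => some r
  | _ => none

/-- The value assigned to the target register, if it is available. -/
def Transient.result {R V L Op : Type*} : Transient R V L Op → Option (LVal V L)
  | .value _ v => some v
  | .loadGuess _ _ v _ _ => some v
  | .loaded _ v _ _ _ => some v
  | _ => none

/-- The transient instruction is a fully resolved assignment `r = v_ℓ` (of an operation or a
load). -/
inductive Transient.IsValue {R V L Op : Type*} : Transient R V L Op → R → LVal V L → Prop
  | value (r : R) (v : LVal V L) : IsValue (.value r v) r v
  | loaded (r : R) (v : LVal V L) (dep : WithBot ℕ) (a pt : V) : IsValue (.loaded r v dep a pt) r v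

/-- Commands recorded in the return stack buffer. -/
inductive RSBCmd (V : Type*) where
  | push (n : V)
  | pop

/-- The effect of a command on a stack (a list whose head is the top). -/
def RSBCmd.apply {V : Type*} (st : List V) : RSBCmd V → List V
  | .push n => n :: st
  | .pop => st.tail

/-- The value on top of the return stack: the commands are applied in the order of their indices,
starting with the empty stack. -/
noncomputable def rsbTop {V : Type*} (σ : FMap (RSBCmd V)) : Option V :=
  (((σ.dom.sort (· ≤ ·)).filterMap σ.get).foldl RSBCmd.apply []).head?

/-- Attacker directives. -/
inductive Directive (V : Type*) where
  | fetch
  | fetchBool (b : Bool)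
  | fetchTo (n : V)
  | exec (i : ℕ)
  | execFwd (i j : ℕ)
  | execValue (i : ℕ)
  | execAddr (i : ℕ)
  | retire

/-- Fetch directives, with or without a guess. -/
def Directive.isFetch {V : Type*} : Directive V → Bool
  | .fetch => true
  | .fetchBool _ => true
  | .fetchTo _ => true
  | _ => false

def Directive.isRetire {V : Type*} : Directive V → Bool
  | .retire => true
  | _ => false

/-- The number of retired instructions of a schedule. -/
def numRetired {V : Type*} (D : List (Directive V)) : ℕ := D.countP Directive.isRetire

/-- Observations. -/
inductive Obs (V L : Type*) where
  | read (a : LVal V L)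
  | fwd (a : LVal V L)
  | write (a : LVal V L)
  | jump (n : LVal V L)
  | rollback

/-- The observation `o` carries the label `ℓ`. -/
def Obs.Carries {V L : Type*} (ℓ : L) : Obs V L → Prop
  | .read a => a.lab = ℓ
  | .fwd a => a.lab = ℓ
  | .write a => a.lab = ℓ
  | .jump n => n.lab = ℓ
  | .rollback => False

/-! ### Machines and configurations -/

/-- The parameters of the semantics: evaluation of opcodes, of branch conditions and of addresses
on unlabelled values, the opcodes moving the stack pointer, the stack pointer and the temporary
register used by returns. -/
structure Machine (R V Op : Type*) where
  evalOp : Op → List V → Option V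
  evalCond : Op → List V → Option Bool
  addr : List V → Option V
  succ : Op
  pred : Op
  rsp : R
  rret : R
  rret_ne_rsp : rret ≠ rsp

/-- A program: the part of memory that maps program points to instructions. -/
abbrev Program (R V L Op : Type*) := V → Option (Instr R V L Op)

/-- Configurations: registers, data memory, current program point, reorder buffer and return
stack buffer. -/
structure Config (R V L Op : Type*) where
  reg : R → Option (LVal V L)
  mem : V → Option (LVal V L)
  pc : V
  buf : FMap (Transient R V L Op)
  rsb : FMap (RSBCmd V)

namespace Config

variable {R V L Op : Type*}

/-- The index of the next fetched instruction. -/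
noncomputable def fresh (C : Config R V L Op) : ℕ := C.buf.maxIdx + 1

/-- `i` is the oldest index of the buffer. -/
def Retirable (C : Config R V L Op) (i : ℕ) : Prop := C.buf.minIdx = i

/-- No fence is pending before index `i`. -/
def NoFence (C : Config R V L Op) (i : ℕ) : Prop := ∀ j < i, C.buf.get j ≠ some .fence

/-- The entry at index `j` assigns register `r`. -/
def Assigns (C : Config R V L Op) (j : ℕ) (r : R) : Prop :=
  ∃ t, C.buf.get j = some t ∧ t.target = some r

open Classical in
/-- The register resolve function: the value of `r` as seen by the instruction at index `i`. This
is the value of the latest assignment to `r` before `i`, undefined if that assignment has no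
value yet, and the value in the register map if there is no such assignment. -/
noncomputable def resolveReg (C : Config R V L Op) (i : ℕ) (r : R) : Option (LVal V L) :=
  if h : ∃ j, IsGreatest {j | j < i ∧ C.Assigns j r} j then
    (C.buf.get h.choose).bind Transient.result
  else C.reg r

/-- The register resolve function on operands. -/
noncomputable def resolve (C : Config R V L Op) (i : ℕ) : Operand R V L → Option (LVal V L)
  | .reg r => C.resolveReg i r
  | .val v => some v

/-- The operands `args` of the instruction at index `i` resolve to the values `vs`. -/
def Resolves (C : Config R V L Op) (i : ℕ) (args : List (Operand R V L))
    (vs : List (LVal V L)) : Prop :=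
  List.Forall₂ (fun rv v => C.resolve i rv = some v) args vs

/-- Operands `args` at index `i` evaluate to the labelled address `a`. -/
def ResolvesAddr [Lattice L] [OrderBot L] (M : Machine R V Op) (C : Config R V L Op) (i : ℕ)
    (args : List (Operand R V L)) (a : LVal V L) : Prop :=
  ∃ vs, C.Resolves i args vs ∧ M.addr (vs.map LVal.val) = some a.val ∧ a.lab = joinLab vs

/-- The entry at index `j` is a store whose address is resolved to `a`. -/
def StoreAt (C : Config R V L Op) (j : ℕ) (a : V) : Prop :=
  ∃ src b, C.buf.get j = some (.store src (.inr b)) ∧ b.val = a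

/-- Resolving the store at `i` to address `a` reveals that the resolved load at `k > i` obtained
its value from the wrong place. -/
def Hazard (C : Config R V L Op) (i : ℕ) (a : V) (k : ℕ) : Prop :=
  i < k ∧ ∃ r v dep b pt, C.buf.get k = some (.loaded r v dep b pt) ∧
    ((b = a ∧ dep < (i : WithBot ℕ)) ∨ (dep = (i : WithBot ℕ) ∧ b ≠ a))

open Classical in
/-- The first buffer index of the physical instruction to which the load at index `k` belongs: `k`
itself, or `k - 1` for the load of a return, which is preceded by the marker `ret`. -/
noncomputable def loadStart (C : Config R V L Op) (k : ℕ) : ℕ :=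
  if C.buf.get (k - 1) = some .ret then k - 1 else k

/-- Configuration after fetching a return with predicted return point `n`. -/
noncomputable def fetchRet (M : Machine R V Op) (C : Config R V L Op) (n : V) :
    Config R V L Op :=
  { C with
    pc := n
    buf := (((C.buf.set C.fresh .ret).set (C.fresh + 1) (.load M.rret [.reg M.rsp] C.pc)).set
      (C.fresh + 2) (.op M.rsp M.pred [.reg M.rsp])).set
      (C.fresh + 3) (.jmpi [.reg M.rret] n)
    rsb := C.rsb.set C.fresh .pop }

/-- Roll back to the buffer indices below `k` and continue at program point `n`. -/
def rollback (C : Config R V L Op) (k : ℕ) (n : V) : Config R V L Op :=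
  { C with pc := n, buf := C.buf.below k, rsb := C.rsb.below k }

/-- Replace the buffer entry at index `i`. -/
def setBuf (C : Config R V L Op) (i : ℕ) (t : Transient R V L Op) : Config R V L Op :=
  { C with buf := C.buf.set i t }

end Config

/-! ### Small-step semantics -/

/-- `Step M P C d O C'`: under directive `d`, configuration `C` steps to `C'` with observations
`O`. -/
inductive Step {R V L Op : Type*} [DecidableEq R] [DecidableEq V] [Lattice L] [OrderBot L]
    (M : Machine R V Op) (P : Program R V L Op) (C : Config R V L Op) :
    Directive V → List (Obs V L) → Config R V L Op → Prop
  -- fetch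
  | op_fetch (o : Op) (r : R) (args : List (Operand R V L)) (next : V)
      (hP : P C.pc = some (.op o r args next)) :
      Step M P C .fetch [] { C.setBuf C.fresh (.op r o args) with pc := next }
  | load_fetch (r : R) (args : List (Operand R V L)) (next : V)
      (hP : P C.pc = some (.load r args next)) :
      Step M P C .fetch [] { C.setBuf C.fresh (.load r args C.pc) with pc := next }
  | store_fetch (src : Operand R V L) (args : List (Operand R V L)) (next : V)
      (hP : P C.pc = some (.store src args next)) :
      Step M P C .fetch [] { C.setBuf C.fresh (.store src (.inl args)) with pc := next }
  | fence_fetch (next : V) (hP : P C.pc = some (.fence next)) :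
      Step M P C .fetch [] { C.setBuf C.fresh .fence with pc := next }
  | br_fetch (b : Bool) (o : Op) (args : List (Operand R V L)) (nT nF : V)
      (hP : P C.pc = some (.br o args nT nF)) :
      Step M P C (.fetchBool b) []
        { C.setBuf C.fresh (.br o args (if b then nT else nF) nT nF) with
          pc := if b then nT else nF }
  | jmpi_fetch (n : V) (args : List (Operand R V L)) (hP : P C.pc = some (.jmpi args)) :
      Step M P C (.fetchTo n) [] { C.setBuf C.fresh (.jmpi args n) with pc := n }
  | call_fetch (nf nret : V) (hP : P C.pc = some (.call nf nret)) :
      Step M P C .fetch []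
        { C with
          pc := nf
          buf := ((C.buf.set C.fresh .call).set (C.fresh + 1)
            (.op M.rsp M.succ [.reg M.rsp])).set (C.fresh + 2)
            (.store (.val ⟨nret, ⊥⟩) (.inl [.reg M.rsp]))
          rsb := C.rsb.set C.fresh (.push nret) }
  | ret_fetch_rsb (n : V) (hP : P C.pc = some .ret) (htop : rsbTop C.rsb = some n) :
      Step M P C .fetch [] (C.fetchRet M n)
  | ret_fetch_rsb_empty (n : V) (hP : P C.pc = some .ret) (htop : rsbTop C.rsb = none) :
      Step M P C (.fetchTo n) [] (C.fetchRet M n)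
  -- execute: operations
  | op_execute (i : ℕ) (r : R) (o : Op) (args : List (Operand R V L)) (vs : List (LVal V L))
      (v : V) (hi : C.buf.get i = some (.op r o args)) (hfence : C.NoFence i)
      (hvs : C.Resolves i args vs) (hv : M.evalOp o (vs.map LVal.val) = some v) :
      Step M P C (.exec i) [] (C.setBuf i (.value r ⟨v, joinLab vs⟩))
  -- execute: conditional branches
  | br_execute_correct (i : ℕ) (o : Op) (args : List (Operand R V L)) (guess nT nF : V)
      (vs : List (LVal V L)) (b : Bool)
      (hi : C.buf.get i = some (.br o args guess nT nF)) (hfence : C.NoFence i)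
      (hvs : C.Resolves i args vs) (hb : M.evalCond o (vs.map LVal.val) = some b)
      (hguess : (if b then nT else nF) = guess) :
      Step M P C (.exec i) [.jump ⟨guess, joinLab vs⟩] (C.setBuf i (.jump guess))
  | br_execute_incorrect (i : ℕ) (o : Op) (args : List (Operand R V L)) (guess nT nF : V)
      (vs : List (LVal V L)) (b : Bool) (n : V)
      (hi : C.buf.get i = some (.br o args guess nT nF)) (hfence : C.NoFence i)
      (hvs : C.Resolves i args vs) (hb : M.evalCond o (vs.map LVal.val) = some b)
      (hn : (if b then nT else nF) = n) (hguess : n ≠ guess) :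
      Step M P C (.exec i) [.rollback, .jump ⟨n, joinLab vs⟩]
        ((C.rollback i n).setBuf i (.jump n))
  -- execute: indirect jumps
  | jmpi_execute_correct (i : ℕ) (args : List (Operand R V L)) (guess : V) (n : LVal V L)
      (hi : C.buf.get i = some (.jmpi args guess)) (hfence : C.NoFence i)
      (hn : C.ResolvesAddr M i args n) (hguess : n.val = guess) :
      Step M P C (.exec i) [.jump n] (C.setBuf i (.jump guess))
  | jmpi_execute_incorrect (i : ℕ) (args : List (Operand R V L)) (guess : V) (n : LVal V L)
      (hi : C.buf.get i = some (.jmpi args guess)) (hfence : C.NoFence i)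
      (hn : C.ResolvesAddr M i args n) (hguess : n.val ≠ guess) :
      Step M P C (.exec i) [.rollback, .jump n] ((C.rollback i n.val).setBuf i (.jump n.val))
  -- execute: loads
  | load_execute_forward (i j : ℕ) (r : R) (args : List (Operand R V L)) (pt : V)
      (a b v : LVal V L)
      (hi : C.buf.get i = some (.load r args pt)) (hfence : C.NoFence i)
      (ha : C.ResolvesAddr M i args a)
      (hj : IsGreatest {k | k < i ∧ C.StoreAt k a.val} j)
      (hv : C.buf.get j = some (.store (.val v) (.inr b))) :
      Step M P C (.exec i) [.fwd a] (C.setBuf i (.loaded r v (j : WithBot ℕ) a.val pt))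
  | load_execute_nodep (i : ℕ) (r : R) (args : List (Operand R V L)) (pt : V)
      (a v : LVal V L)
      (hi : C.buf.get i = some (.load r args pt)) (hfence : C.NoFence i)
      (ha : C.ResolvesAddr M i args a)
      (hj : ∀ k < i, ¬ C.StoreAt k a.val) (hv : C.mem a.val = some v) :
      Step M P C (.exec i) [.read a] (C.setBuf i (.loaded r v ⊥ a.val pt))
  -- execute: loads with a guessed alias
  | load_execute_guess (i j : ℕ) (r : R) (args : List (Operand R V L)) (pt : V) (v : LVal V L)
      (dst : List (Operand R V L) ⊕ LVal V L)
      (hi : C.buf.get i = some (.load r args pt)) (hfence : C.NoFence i) (hji : j < i)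
      (hj : C.buf.get j = some (.store (.val v) dst)) :
      Step M P C (.execFwd i j) [] (C.setBuf i (.loadGuess r args v j pt))
  | load_execute_addr_ok (i j : ℕ) (r : R) (args : List (Operand R V L)) (pt : V)
      (a v : LVal V L) (dst : List (Operand R V L) ⊕ LVal V L)
      (hi : C.buf.get i = some (.loadGuess r args v j pt)) (hfence : C.NoFence i)
      (ha : C.ResolvesAddr M i args a)
      (hj : C.buf.get j = some (.store (.val v) dst)) (hdst : ∀ b, dst = .inr b → b.val = a.val)
      (hk : ∀ k, j < k → k < i → ¬ C.StoreAt k a.val) :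
      Step M P C (.exec i) [.fwd a] (C.setBuf i (.loaded r v (j : WithBot ℕ) a.val pt))
  | load_execute_addr_hazard (i j : ℕ) (r : R) (args : List (Operand R V L)) (pt : V)
      (a v : LVal V L)
      (hi : C.buf.get i = some (.loadGuess r args v j pt)) (hfence : C.NoFence i)
      (ha : C.ResolvesAddr M i args a)
      (hj : (∃ b, b ≠ a.val ∧ C.StoreAt j b) ∨ ∃ k, j < k ∧ k < i ∧ C.StoreAt k a.val) :
      Step M P C (.exec i) [.rollback, .fwd a] (C.rollback (C.loadStart i) pt)
  | load_execute_mem_match (i j : ℕ) (r : R) (args : List (Operand R V L)) (pt : V)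
      (a v : LVal V L)
      (hi : C.buf.get i = some (.loadGuess r args v j pt)) (hfence : C.NoFence i)
      (ha : C.ResolvesAddr M i args a)
      (hj : C.buf.get j = none) (hk : ∀ k < i, ¬ C.StoreAt k a.val)
      (hv : C.mem a.val = some v) :
      Step M P C (.exec i) [.read a] (C.setBuf i (.loaded r v ⊥ a.val pt))
  | load_execute_mem_hazard (i j : ℕ) (r : R) (args : List (Operand R V L)) (pt : V)
      (a v w : LVal V L)
      (hi : C.buf.get i = some (.loadGuess r args v j pt)) (hfence : C.NoFence i)
      (ha : C.ResolvesAddr M i args a)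
      (hj : C.buf.get j = none) (hk : ∀ k < i, ¬ C.StoreAt k a.val)
      (hw : C.mem a.val = some w) (hne : w ≠ v) :
      Step M P C (.exec i) [.rollback, .read a] (C.rollback (C.loadStart i) pt)
  -- execute: stores
  | store_execute_value (i : ℕ) (src : Operand R V L) (dst : List (Operand R V L) ⊕ LVal V L)
      (v : LVal V L)
      (hi : C.buf.get i = some (.store src dst)) (hfence : C.NoFence i)
      (hv : C.resolve i src = some v) :
      Step M P C (.execValue i) [] (C.setBuf i (.store (.val v) dst))
  | store_execute_addr_ok (i : ℕ) (src : Operand R V L) (args : List (Operand R V L))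
      (a : LVal V L)
      (hi : C.buf.get i = some (.store src (.inl args))) (hfence : C.NoFence i)
      (ha : C.ResolvesAddr M i args a) (hk : ∀ k, ¬ C.Hazard i a.val k) :
      Step M P C (.execAddr i) [.fwd a] (C.setBuf i (.store src (.inr a)))
  | store_execute_addr_hazard (i k : ℕ) (src : Operand R V L) (args : List (Operand R V L))
      (a : LVal V L) (r : R) (v : LVal V L) (dep : WithBot ℕ) (b pt : V)
      (hi : C.buf.get i = some (.store src (.inl args))) (hfence : C.NoFence i)
      (ha : C.ResolvesAddr M i args a) (hk : IsLeast {k | C.Hazard i a.val k} k)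
      (hload : C.buf.get k = some (.loaded r v dep b pt)) :
      Step M P C (.execAddr i) [.rollback, .fwd a]
        ((C.rollback (C.loadStart k) pt).setBuf i (.store src (.inr a)))
  -- retire
  | value_retire (i : ℕ) (t : Transient R V L Op) (r : R) (v : LVal V L)
      (hmin : C.Retirable i) (hi : C.buf.get i = some t) (ht : t.IsValue r v) :
      Step M P C .retire []
        { C with reg := Function.update C.reg r (some v), buf := C.buf.erase i }
  | jump_retire (i : ℕ) (n : V) (hmin : C.Retirable i) (hi : C.buf.get i = some (.jump n)) :
      Step M P C .retire [] { C with buf := C.buf.erase i }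
  | fence_retire (i : ℕ) (hmin : C.Retirable i) (hi : C.buf.get i = some .fence) :
      Step M P C .retire [] { C with buf := C.buf.erase i }
  | store_retire (i : ℕ) (v a : LVal V L) (hmin : C.Retirable i)
      (hi : C.buf.get i = some (.store (.val v) (.inr a))) :
      Step M P C .retire [.write a]
        { C with mem := Function.update C.mem a.val (some v), buf := C.buf.erase i }
  | call_retire (i : ℕ) (vsp v a : LVal V L) (hmin : C.Retirable i)
      (hi : C.buf.get i = some .call)
      (hi1 : C.buf.get (i + 1) = some (.value M.rsp vsp))
      (hi2 : C.buf.get (i + 2) = some (.store (.val v) (.inr a))) :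
      Step M P C .retire [.write a]
        { C with
          reg := Function.update C.reg M.rsp (some vsp)
          mem := Function.update C.mem a.val (some v)
          buf := C.buf.above (i + 2) }
  | ret_retire (i : ℕ) (t1 t2 : Transient R V L Op) (v1 v2 : LVal V L) (n : V)
      (hmin : C.Retirable i) (hi : C.buf.get i = some .ret)
      (hi1 : C.buf.get (i + 1) = some t1) (ht1 : t1.IsValue M.rret v1)
      (hi2 : C.buf.get (i + 2) = some t2) (ht2 : t2.IsValue M.rsp v2)
      (hi3 : C.buf.get (i + 3) = some (.jump n)) :
      Step M P C .retire []
        { C with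
          reg := Function.update C.reg M.rsp (some v2)
          buf := C.buf.above (i + 3) }

/-! ### Executions -/

/-- `Exec M P C D O C'`: executing the schedule `D` from `C` leads to `C'` with trace `O`. -/
inductive Exec {R V L Op : Type*} [DecidableEq R] [DecidableEq V] [Lattice L] [OrderBot L]
    (M : Machine R V Op) (P : Program R V L Op) :
    Config R V L Op → List (Directive V) → List (Obs V L) → Config R V L Op → Prop
  | nil (C : Config R V L Op) : Exec M P C [] [] C
  | cons {C C' C'' : Config R V L Op} {d : Directive V} {D : List (Directive V)}
      {O O' : List (Obs V L)} (h : Step M P C d O C') (h' : Exec M P C' D O' C'') :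
      Exec M P C (d :: D) (O ++ O') C''

/-- Initial (equivalently, terminal) configurations: nothing is in flight. -/
def Config.Idle {R V L Op : Type*} (C : Config R V L Op) : Prop := C.buf = FMap.empty

/-- A schedule is sequential for `C` if at every fetch all previously fetched instructions have
already been executed and retired, i.e. the reorder buffer is empty. -/
def IsSequential {R V L Op : Type*} [DecidableEq R] [DecidableEq V] [Lattice L] [OrderBot L]
    (M : Machine R V Op) (P : Program R V L Op) (C : Config R V L Op)
    (D : List (Directive V)) : Prop :=
  ∀ (D₁ D₂ : List (Directive V)) (d : Directive V) (O : List (Obs V L)) (C' : Config R V L Op),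
    D = D₁ ++ d :: D₂ → d.isFetch = true → Exec M P C D₁ O C' → C'.Idle

/-- Sequential executions: they start in an initial configuration, end in a terminal one, and
follow a sequential schedule. -/
def SeqExec {R V L Op : Type*} [DecidableEq R] [DecidableEq V] [Lattice L] [OrderBot L]
    (M : Machine R V Op) (P : Program R V L Op) (C : Config R V L Op)
    (D : List (Directive V)) (O : List (Obs V L)) (C' : Config R V L Op) : Prop :=
  C.Idle ∧ IsSequential M P C D ∧ Exec M P C D O C' ∧ C'.Idle

/-- The register `r` is not an explicit operand of any instruction of the program. -/
def Program.NotRead {R V L Op : Type*} (P : Program R V L Op) (r : R) : Prop :=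
  ∀ n ins, P n = some ins → Operand.reg r ∉ ins.operands

end Spec

namespace Spec

section

variable {R V L Op : Type*}

/-! ### Lookups and extremal indices of finite maps. -/

namespace FMap

variable {T : Type*}

/-! Exposed labels are an architectural notion. In-order execution (`ArchStep`) is deterministic and
attaches to each instruction the labels of the addresses and jump targets that it computes. Let A(N)
be the set collected in N steps; it grows with N (`ArchRun.labels_subset`). The theorem combines
three facts: a trace that retires N instructions contains every label of A(N) (`Exec.archRun`); a
sequential trace contains no other labels (`SeqExec.archRun`); and every architectural run is
realised by a sequential execution (`ArchRun.exists_seqExec`). For N' ≤ N the labels of the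
sequential trace then lie in A(N') ⊆ A(N), hence among those of the speculative trace.

The first fact is a simulation. By the invariant `Inv`, the buffer is a contiguous block of indices,
cut into instructions that are linked by their predicted successors (`Chain`), and each entry is a
consistent stage of the entry that was fetched (`Refines`). An available result never changes while
its entry stays in the buffer, so stages persist (`Inv.update`). The delicate stage is a resolved
load: `LoadOk` says that its source is right with respect to the stores whose addresses are known.
The hazard check preserves this when another address becomes known (`LoadOk.set_storeAddr`), and
retirement turns a source store into a source in memory (`LoadOk.drop`). The oldest instruction has
nothing in front of it, so its fully resolved stage is an architectural step (`Step.retirePost`).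

Each buffer entry also carries the labels exposed by resolving it; these have already been observed.
A rollback discards entries but not observations, so speculation yields an inclusion only. With one
instruction in flight and no guessed loads, the only rollback is the correction of a jump, which is
the last entry of its instruction. No label is lost then, and in a terminal configuration all of
them belong to retired instructions. This gives the second fact.

A return does not commit the temporary register, so buffered and committed registers may disagree
there. This is harmless because only the jump of a return reads that register, after the load of the
same return (`Chain.exists_load_rret`). -/

theorem ext_get {m m' : FMap T} (h : ∀ i, m.get i = m'.get i) : m = m' := by
  cases m; cases m'
  simp only [mk.injEq]
  exact funext h

@[simp] theorem get_empty (i : ℕ) : (empty : FMap T).get i = none := rfl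

@[simp] theorem get_set_self (m : FMap T) (i : ℕ) (t : T) : (m.set i t).get i = some t := by
  simp [set]

theorem get_set_of_ne (m : FMap T) {i j : ℕ} (t : T) (h : j ≠ i) :
    (m.set i t).get j = m.get j := by
  simp [set, h]

theorem get_set (m : FMap T) (i j : ℕ) (t : T) :
    (m.set i t).get j = if j = i then some t else m.get j := by
  simp [set, Function.update_apply]

theorem get_below (m : FMap T) (i j : ℕ) :
    (m.below i).get j = if j < i then m.get j else none := rfl

theorem get_above (m : FMap T) (i j : ℕ) :
    (m.above i).get j = if i < j then m.get j else none := rfl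

theorem get_erase (m : FMap T) (i j : ℕ) :
    (m.erase i).get j = if j ≠ i then m.get j else none := rfl

theorem maxIdx_empty : (empty : FMap T).maxIdx = 0 := by
  have : (empty : FMap T).dom = ∅ := by
    ext i; simp [dom]
  simp [maxIdx, this]

/-- Identifies the fetch index with the end of a contiguous block. The block has to be nonempty
because the empty map has `maxIdx` equal to `0`. -/
theorem maxIdx_add_one {m : FMap T} {b e : ℕ} (hbe : b < e)
    (h : ∀ k, m.get k ≠ none ↔ b ≤ k ∧ k < e) : m.maxIdx + 1 = e := by
  have hdom : ∀ k, k ∈ m.dom ↔ b ≤ k ∧ k < e := fun k => by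
    rw [← h k]; simp [dom]
  have h1 : m.maxIdx ≤ e - 1 := Finset.sup_le fun k hk => by
    have := (hdom k).1 hk
    simp only [id]; omega
  have h2 : e - 1 ≤ m.maxIdx :=
    Finset.le_sup (f := id) ((hdom (e - 1)).2 ⟨by omega, by omega⟩)
  omega

theorem minIdx_eq {m : FMap T} {b : ℕ} (hb : m.get b ≠ none)
    (h : ∀ k, m.get k ≠ none → b ≤ k) : m.minIdx = b :=
  IsLeast.csInf_eq ⟨hb, h⟩

end FMap

/-! ### Operand evaluation -/

/-- The value of an operand under a register assignment. -/
def evalOperand (f : R → Option (LVal V L)) : Operand R V L → Option (LVal V L)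
  | .reg r => f r
  | .val v => some v

/-- The values of a list of operands under a register assignment. -/
def EvalArgs (f : R → Option (LVal V L)) (args : List (Operand R V L))
    (vs : List (LVal V L)) : Prop :=
  List.Forall₂ (fun rv v => evalOperand f rv = some v) args vs

/-- The labelled address that a list of operands denotes under a register assignment. -/
def EvalAddr [Lattice L] [OrderBot L] (M : Machine R V Op) (f : R → Option (LVal V L))
    (args : List (Operand R V L)) (a : LVal V L) : Prop :=
  ∃ vs, EvalArgs f args vs ∧ M.addr (vs.map LVal.val) = some a.val ∧ a.lab = joinLab vs

theorem EvalArgs.functional {f : R → Option (LVal V L)} {args : List (Operand R V L)}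
    {vs ws : List (LVal V L)} (h : EvalArgs f args vs) (h' : EvalArgs f args ws) : vs = ws := by
  unfold EvalArgs at h h'
  induction h generalizing ws with
  | nil => cases h'; rfl
  | cons h₁ _ ih =>
    cases h' with
    | cons h₂ h₃ =>
      rw [h₁] at h₂
      rw [Option.some.inj h₂, ih h₃]

theorem EvalAddr.functional [Lattice L] [OrderBot L] {M : Machine R V Op}
    {f : R → Option (LVal V L)} {args : List (Operand R V L)} {a a' : LVal V L}
    (h : EvalAddr M f args a) (h' : EvalAddr M f args a') : a = a' := by
  obtain ⟨vs, h1, h2, h3⟩ := h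
  obtain ⟨ws, h1', h2', h3'⟩ := h'
  obtain rfl := h1.functional h1'
  rw [h2] at h2'
  exact LVal.ext (Option.some.inj h2') (h3.trans h3'.symm)

theorem evalOperand_mono {f g : R → Option (LVal V L)} {rv : Operand R V L}
    (hfg : ∀ r, rv = .reg r → ∀ v, f r = some v → g r = some v) {v : LVal V L}
    (h : evalOperand f rv = some v) : evalOperand g rv = some v := by
  cases rv with
  | reg r => exact hfg r rfl v h
  | val w => exact h

theorem EvalArgs.mono {f g : R → Option (LVal V L)} {args : List (Operand R V L)}
    {vs : List (LVal V L)} (h : EvalArgs f args vs)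
    (hfg : ∀ r, .reg r ∈ args → ∀ v, f r = some v → g r = some v) : EvalArgs g args vs := by
  unfold EvalArgs at h ⊢
  induction h with
  | nil => exact .nil
  | cons h₁ _ ih =>
    refine .cons (evalOperand_mono (fun r hr => hfg r ?_) h₁)
      (ih fun r hr => hfg r (List.mem_cons_of_mem _ hr))
    simp [hr]

theorem EvalAddr.mono [Lattice L] [OrderBot L] {M : Machine R V Op}
    {f g : R → Option (LVal V L)} {args : List (Operand R V L)} {a : LVal V L}
    (h : EvalAddr M f args a)
    (hfg : ∀ r, .reg r ∈ args → ∀ v, f r = some v → g r = some v) : EvalAddr M g args a := by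
  obtain ⟨vs, h1, h2⟩ := h
  exact ⟨vs, h1.mono hfg, h2⟩

/-! ### Recursion on the index for the register resolve function. -/

namespace Config

theorem resolve_eq (C : Config R V L Op) (i : ℕ) :
    C.resolve i = evalOperand (C.resolveReg i) := by
  funext rv
  cases rv <;> rfl

theorem resolves_iff (C : Config R V L Op) (i : ℕ) (args : List (Operand R V L))
    (vs : List (LVal V L)) : C.Resolves i args vs ↔ EvalArgs (C.resolveReg i) args vs := by
  simp only [Resolves, EvalArgs, resolve_eq]

theorem resolvesAddr_iff [Lattice L] [OrderBot L] (M : Machine R V Op) (C : Config R V L Op)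
    (i : ℕ) (args : List (Operand R V L)) (a : LVal V L) :
    C.ResolvesAddr M i args a ↔ EvalAddr M (C.resolveReg i) args a := by
  simp only [ResolvesAddr, EvalAddr, resolves_iff]

theorem resolveReg_zero (C : Config R V L Op) : C.resolveReg 0 = C.reg := by
  funext r
  unfold resolveReg
  rw [dif_neg]
  rintro ⟨j, hj⟩
  exact absurd hj.1.1 (Nat.not_lt_zero j)

/-- Together with `resolveReg_zero` and `resolveReg_succ_of_not_assigns`, this replaces the choice
of a greatest assignment by a recursion on the index, on which all later arguments rely. -/
theorem resolveReg_succ_of_assigns {C : Config R V L Op} {i : ℕ} {r : R}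
    (h : C.Assigns i r) :
    C.resolveReg (i + 1) r = (C.buf.get i).bind Transient.result := by
  have hg : IsGreatest {j | j < i + 1 ∧ C.Assigns j r} i :=
    ⟨⟨Nat.lt_succ_self i, h⟩, fun j hj => Nat.lt_succ_iff.1 hj.1⟩
  have hex : ∃ j, IsGreatest {j | j < i + 1 ∧ C.Assigns j r} j := ⟨i, hg⟩
  unfold resolveReg
  rw [dif_pos hex, hex.choose_spec.unique hg]

theorem resolveReg_succ_of_not_assigns {C : Config R V L Op} {i : ℕ} {r : R}
    (h : ¬ C.Assigns i r) : C.resolveReg (i + 1) r = C.resolveReg i r := by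
  have hs : {j | j < i + 1 ∧ C.Assigns j r} = {j | j < i ∧ C.Assigns j r} := by
    ext j
    refine ⟨fun ⟨h1, h2⟩ => ⟨?_, h2⟩, fun ⟨h1, h2⟩ => ⟨by omega, h2⟩⟩
    rcases Nat.lt_succ_iff_lt_or_eq.1 h1 with h1 | rfl
    · exact h1
    · exact absurd h2 h
  unfold resolveReg
  by_cases hex : ∃ j, IsGreatest {j | j < i ∧ C.Assigns j r} j
  · have hex' : ∃ j, IsGreatest {j | j < i + 1 ∧ C.Assigns j r} j := by rw [hs]; exact hex
    have hspec : IsGreatest {j | j < i ∧ C.Assigns j r} hex'.choose :=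
      (congrArg (fun S => IsGreatest S hex'.choose) hs).mp hex'.choose_spec
    rw [dif_pos hex, dif_pos hex', hex.choose_spec.unique hspec]
  · have hex' : ¬ ∃ j, IsGreatest {j | j < i + 1 ∧ C.Assigns j r} j := by rw [hs]; exact hex
    rw [dif_neg hex, dif_neg hex']

theorem resolveReg_succ_none {C : Config R V L Op} {i : ℕ} (h : C.buf.get i = none) :
    C.resolveReg (i + 1) = C.resolveReg i := by
  funext r
  refine resolveReg_succ_of_not_assigns ?_
  rintro ⟨t, ht, -⟩
  simp [h] at ht

theorem resolveReg_succ_no_target {C : Config R V L Op} {i : ℕ} {t : Transient R V L Op}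
    (h : C.buf.get i = some t) (ht : t.target = none) :
    C.resolveReg (i + 1) = C.resolveReg i := by
  funext r
  refine resolveReg_succ_of_not_assigns ?_
  rintro ⟨t', ht', h'⟩
  obtain rfl := Option.some.inj (h.symm.trans ht')
  simp [ht] at h'

theorem resolveReg_succ_target [DecidableEq R] {C : Config R V L Op} {i : ℕ}
    {t : Transient R V L Op} {r : R}
    (h : C.buf.get i = some t) (ht : t.target = some r) :
    C.resolveReg (i + 1) = Function.update (C.resolveReg i) r t.result := by
  funext r'
  by_cases hr : r' = r
  · subst hr
    rw [resolveReg_succ_of_assigns ⟨t, h, ht⟩, Function.update_self, h]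
    rfl
  · rw [Function.update_of_ne hr]
    refine resolveReg_succ_of_not_assigns ?_
    rintro ⟨t', ht', h'⟩
    obtain rfl := Option.some.inj (h.symm.trans ht')
    rw [ht] at h'
    exact hr (Option.some.inj h').symm

theorem resolveReg_eq_reg {C : Config R V L Op} {i : ℕ} (h : ∀ j < i, C.buf.get j = none) :
    C.resolveReg i = C.reg := by
  induction i with
  | zero => exact resolveReg_zero C
  | succ i ih =>
    rw [resolveReg_succ_none (h i (Nat.lt_succ_self i)), ih fun j hj => h j (by omega)]

theorem resolveReg_congr {C C' : Config R V L Op} {i : ℕ} (hreg : C'.reg = C.reg)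
    (h : ∀ j < i, C'.buf.get j = C.buf.get j) : C'.resolveReg i = C.resolveReg i := by
  induction i with
  | zero => rw [resolveReg_zero, resolveReg_zero, hreg]
  | succ i ih =>
    have ih' := ih fun j hj => h j (by omega)
    have hi := h i (Nat.lt_succ_self i)
    have hA : ∀ r, C'.Assigns i r ↔ C.Assigns i r := fun r => by simp only [Assigns, hi]
    funext r
    by_cases hr : C.Assigns i r
    · rw [resolveReg_succ_of_assigns hr, resolveReg_succ_of_assigns ((hA r).2 hr), hi]
    · rw [resolveReg_succ_of_not_assigns hr,
        resolveReg_succ_of_not_assigns (fun h => hr ((hA r).1 h)), ih']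

/-- Register resolution is monotone in the register assignment on which a segment of the buffer is
based and in the results of the entries of that segment. -/
theorem resolveReg_mono {C C' : Config R V L Op} {b i : ℕ} {r : R} {v : LVal V L} (hbi : b ≤ i)
    (hbase : (∀ j, b ≤ j → j < i → ¬ C.Assigns j r) →
      ∀ v, C.resolveReg b r = some v → C'.resolveReg b r = some v)
    (hA : ∀ j, b ≤ j → j < i → (C'.Assigns j r ↔ C.Assigns j r))
    (hres : ∀ j, b ≤ j → j < i → ∀ v, (C.buf.get j).bind Transient.result = some v →
      (C'.buf.get j).bind Transient.result = some v)
    (h : C.resolveReg i r = some v) : C'.resolveReg i r = some v := by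
  induction i, hbi using Nat.le_induction with
  | base => exact hbase (fun j h1 h2 => by omega) v h
  | succ i hbi ih =>
    by_cases hr : C.Assigns i r
    · rw [resolveReg_succ_of_assigns hr] at h
      rw [resolveReg_succ_of_assigns ((hA i hbi (Nat.lt_succ_self i)).2 hr)]
      exact hres i hbi (Nat.lt_succ_self i) v h
    · rw [resolveReg_succ_of_not_assigns hr] at h
      rw [resolveReg_succ_of_not_assigns fun h' =>
        hr ((hA i hbi (Nat.lt_succ_self i)).1 h')]
      refine ih (fun hn => hbase fun j h1 h2 => ?_) (fun j h1 h2 => hA j h1 (by omega))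
        (fun j h1 h2 => hres j h1 (by omega)) h
      rcases Nat.lt_succ_iff_lt_or_eq.1 h2 with h2 | rfl
      · exact hn j h1 h2
      · exact hr

end Config

/-! ### Labels of observations -/

/-- The labels carried by the observations of a trace. -/
def obsLabels (O : List (Obs V L)) : Set L := {l | ∃ o ∈ O, o.Carries l}

@[simp] theorem obsLabels_nil : obsLabels ([] : List (Obs V L)) = ∅ := by
  simp [obsLabels]

theorem obsLabels_cons (o : Obs V L) (O : List (Obs V L)) :
    obsLabels (o :: O) = {l | o.Carries l} ∪ obsLabels O := by
  ext l
  simp [obsLabels]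

@[simp] theorem obsLabels_append (O O' : List (Obs V L)) :
    obsLabels (O ++ O') = obsLabels O ∪ obsLabels O' := by
  ext l
  simp [obsLabels, or_and_right, exists_or]

@[simp] theorem obsLabels_rollback (O : List (Obs V L)) :
    obsLabels (.rollback :: O) = obsLabels O := by
  simp [obsLabels_cons, Obs.Carries]

@[simp] theorem obsLabels_read (a : LVal V L) : obsLabels [.read a] = {a.lab} := by
  ext l; simp [obsLabels, Obs.Carries, eq_comm]

@[simp] theorem obsLabels_fwd (a : LVal V L) : obsLabels [.fwd a] = {a.lab} := by
  ext l; simp [obsLabels, Obs.Carries, eq_comm]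

@[simp] theorem obsLabels_write (a : LVal V L) : obsLabels [.write a] = {a.lab} := by
  ext l; simp [obsLabels, Obs.Carries, eq_comm]

@[simp] theorem obsLabels_jump (a : LVal V L) : obsLabels [.jump a] = {a.lab} := by
  ext l; simp [obsLabels, Obs.Carries, eq_comm]

/-! ### The architectural machine -/

/-- Architectural states: registers, data memory and program point. -/
structure ArchState (R V L : Type*) where
  reg : R → Option (LVal V L)
  mem : V → Option (LVal V L)
  pc : V

/-- In-order execution of a single instruction; the set collects the labels that it exposes. -/
inductive ArchStep [DecidableEq R] [DecidableEq V] [Lattice L] [OrderBot L]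
    (M : Machine R V Op) (P : Program R V L Op) (s : ArchState R V L) :
    Set L → ArchState R V L → Prop
  | op {o : Op} {r : R} {args : List (Operand R V L)} {next : V} {vs : List (LVal V L)} {v : V}
      (hP : P s.pc = some (.op o r args next)) (hvs : EvalArgs s.reg args vs)
      (hv : M.evalOp o (vs.map LVal.val) = some v) :
      ArchStep M P s ∅ ⟨Function.update s.reg r (some ⟨v, joinLab vs⟩), s.mem, next⟩
  | br {o : Op} {args : List (Operand R V L)} {nT nF : V} {vs : List (LVal V L)} {c : Bool}
      (hP : P s.pc = some (.br o args nT nF)) (hvs : EvalArgs s.reg args vs)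
      (hc : M.evalCond o (vs.map LVal.val) = some c) :
      ArchStep M P s {joinLab vs} ⟨s.reg, s.mem, if c then nT else nF⟩
  | load {r : R} {args : List (Operand R V L)} {next : V} {a v : LVal V L}
      (hP : P s.pc = some (.load r args next)) (ha : EvalAddr M s.reg args a)
      (hv : s.mem a.val = some v) :
      ArchStep M P s {a.lab} ⟨Function.update s.reg r (some v), s.mem, next⟩
  | store {src : Operand R V L} {args : List (Operand R V L)} {next : V} {a v : LVal V L}
      (hP : P s.pc = some (.store src args next)) (ha : EvalAddr M s.reg args a)
      (hv : evalOperand s.reg src = some v) :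
      ArchStep M P s {a.lab} ⟨s.reg, Function.update s.mem a.val (some v), next⟩
  | jmpi {args : List (Operand R V L)} {a : LVal V L}
      (hP : P s.pc = some (.jmpi args)) (ha : EvalAddr M s.reg args a) :
      ArchStep M P s {a.lab} ⟨s.reg, s.mem, a.val⟩
  | call {nf nret : V} {vs : List (LVal V L)} {v : V} {a : LVal V L}
      (hP : P s.pc = some (.call nf nret)) (hvs : EvalArgs s.reg [.reg M.rsp] vs)
      (hv : M.evalOp M.succ (vs.map LVal.val) = some v)
      (ha : EvalAddr M (Function.update s.reg M.rsp (some ⟨v, joinLab vs⟩)) [.reg M.rsp] a) :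
      ArchStep M P s {a.lab} ⟨Function.update s.reg M.rsp (some ⟨v, joinLab vs⟩),
        Function.update s.mem a.val (some ⟨nret, ⊥⟩), nf⟩
  | ret {vs : List (LVal V L)} {v : V} {a w n : LVal V L}
      (hP : P s.pc = some .ret) (ha : EvalAddr M s.reg [.reg M.rsp] a)
      (hw : s.mem a.val = some w) (hvs : EvalArgs s.reg [.reg M.rsp] vs)
      (hv : M.evalOp M.pred (vs.map LVal.val) = some v)
      -- The temporary register holds the return address only while the jump target is computed. The
      -- successor state does not keep it, as in `Step.ret_retire`.
      (hn : EvalAddr M (Function.update s.reg M.rret (some w)) [.reg M.rret] n) :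
      ArchStep M P s {a.lab, n.lab}
        ⟨Function.update s.reg M.rsp (some ⟨v, joinLab vs⟩), s.mem, n.val⟩
  | fence {next : V} (hP : P s.pc = some (.fence next)) :
      ArchStep M P s ∅ ⟨s.reg, s.mem, next⟩

/-- The program point fixes the instruction, and evaluation of operands is functional. Determinism
is what makes the labels of different executions comparable. -/
theorem ArchStep.functional [DecidableEq R] [DecidableEq V] [Lattice L] [OrderBot L]
    {M : Machine R V Op} {P : Program R V L Op} {s s₁ s₂ : ArchState R V L} {T₁ T₂ : Set L}
    (h₁ : ArchStep M P s T₁ s₁) (h₂ : ArchStep M P s T₂ s₂) : T₁ = T₂ ∧ s₁ = s₂ := by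
  cases h₁ with
  | op hP hvs hv =>
    cases h₂ with
    | op hP' hvs' hv' =>
      cases hP.symm.trans hP'
      obtain rfl := hvs.functional hvs'
      cases hv.symm.trans hv'
      exact ⟨rfl, rfl⟩
    | _ => simp_all
  | br hP hvs hc =>
    cases h₂ with
    | br hP' hvs' hc' =>
      cases hP.symm.trans hP'
      obtain rfl := hvs.functional hvs'
      cases hc.symm.trans hc'
      exact ⟨rfl, rfl⟩
    | _ => simp_all
  | load hP ha hv =>
    cases h₂ with
    | load hP' ha' hv' =>
      cases hP.symm.trans hP'
      obtain rfl := ha.functional ha'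
      cases hv.symm.trans hv'
      exact ⟨rfl, rfl⟩
    | _ => simp_all
  | store hP ha hv =>
    cases h₂ with
    | store hP' ha' hv' =>
      cases hP.symm.trans hP'
      obtain rfl := ha.functional ha'
      cases hv.symm.trans hv'
      exact ⟨rfl, rfl⟩
    | _ => simp_all
  | jmpi hP ha =>
    cases h₂ with
    | jmpi hP' ha' =>
      cases hP.symm.trans hP'
      obtain rfl := ha.functional ha'
      exact ⟨rfl, rfl⟩
    | _ => simp_all
  | call hP hvs hv ha =>
    cases h₂ with
    | call hP' hvs' hv' ha' =>
      cases hP.symm.trans hP'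
      obtain rfl := hvs.functional hvs'
      cases hv.symm.trans hv'
      obtain rfl := ha.functional ha'
      exact ⟨rfl, rfl⟩
    | _ => simp_all
  | ret hP ha hw hvs hv hn =>
    cases h₂ with
    | ret hP' ha' hw' hvs' hv' hn' =>
      obtain rfl := ha.functional ha'
      cases hw.symm.trans hw'
      obtain rfl := hvs.functional hvs'
      cases hv.symm.trans hv'
      obtain rfl := hn.functional hn'
      exact ⟨rfl, rfl⟩
    | _ => simp_all
  | fence hP =>
    cases h₂ with
    | fence hP' =>
      cases hP.symm.trans hP'
      exact ⟨rfl, rfl⟩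
    | _ => simp_all

/-- A run of `n` architectural steps, with the labels that it exposes. -/
inductive ArchRun [DecidableEq R] [DecidableEq V] [Lattice L] [OrderBot L]
    (M : Machine R V Op) (P : Program R V L Op) :
    ArchState R V L → ℕ → Set L → ArchState R V L → Prop
  | nil (s : ArchState R V L) : ArchRun M P s 0 ∅ s
  | cons {s s₁ s₂ : ArchState R V L} {n : ℕ} {T A : Set L} (h : ArchStep M P s T s₁)
      (h' : ArchRun M P s₁ n A s₂) : ArchRun M P s (n + 1) (T ∪ A) s₂

/-- By determinism the shorter run is a prefix of the longer one. -/
theorem ArchRun.labels_subset [DecidableEq R] [DecidableEq V] [Lattice L] [OrderBot L]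
    {M : Machine R V Op} {P : Program R V L Op} {s s₁ s₂ : ArchState R V L} {n₁ n₂ : ℕ}
    {A₁ A₂ : Set L} (h₁ : ArchRun M P s n₁ A₁ s₁) (h₂ : ArchRun M P s n₂ A₂ s₂)
    (hn : n₁ ≤ n₂) : A₁ ⊆ A₂ := by
  induction h₁ generalizing n₂ A₂ with
  | nil s => exact Set.empty_subset _
  | cons h _ ih =>
    cases h₂ with
    | nil => omega
    | cons h' h₂ =>
      obtain ⟨rfl, rfl⟩ := h.functional h'
      exact Set.union_subset_union_right _ (ih h₂ (by omega))

end

section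

variable {R V L Op : Type*}

/-! ### Consistency of the reorder buffer -/

/-- The operands of an unresolved transient instruction. -/
def Transient.operands : Transient R V L Op → List (Operand R V L)
  | .op _ _ args => args
  | .br _ args _ _ _ => args
  | .load _ args _ => args
  | .store src (.inl args) => src :: args
  | .jmpi args _ => args
  | _ => []

/-- The value `v` of the resolved load at index `k` from address `a` is the one determined by the
stores before `k` whose addresses are known. -/
structure LoadOk (C : Config R V L Op) (k : ℕ) (v : LVal V L) (dep : WithBot ℕ) (a : V) :
    Prop where
  dep_lt : dep < (k : WithBot ℕ)
  -- No store of known address `a` lies strictly between the source and the load. Stores of unknown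
  -- address are left to the hazard check.
  le_dep : ∀ j < k, C.StoreAt j a → (j : WithBot ℕ) ≤ dep
  -- The second alternative covers values read from memory, where `dep = ⊥` makes the emptiness
  -- condition vacuous, and values forwarded from a store that has been retired since.
  source : (∃ (j : ℕ) (dst : List (Operand R V L) ⊕ LVal V L),
      dep = (j : WithBot ℕ) ∧ C.buf.get j = some (.store (.val v) dst) ∧
        ∀ b, dst = .inr b → b.val = a) ∨
    ((∀ j : ℕ, dep = (j : WithBot ℕ) → ∀ i ≤ j, C.buf.get i = none) ∧ C.mem a = some v)

theorem LoadOk.congr {C C' : Config R V L Op} {k : ℕ} {v : LVal V L}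
    {dep : WithBot ℕ} {a : V} (h : LoadOk C k v dep a) (hmem : C'.mem = C.mem)
    (hbuf : ∀ j < k, C'.buf.get j = C.buf.get j) :
    LoadOk C' k v dep a where
  dep_lt := h.dep_lt
  le_dep := fun j hj hs => h.le_dep j hj (by simpa only [Config.StoreAt, hbuf j hj] using hs)
  source := by
    rcases h.source with ⟨j, dst, hd, hj, hb⟩ | ⟨h1, h2⟩
    · refine .inl ⟨j, dst, hd, ?_, hb⟩
      rw [hbuf j, hj]
      have := h.dep_lt
      rw [hd] at this
      exact WithBot.coe_lt_coe.1 this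
    · refine .inr ⟨fun j hd i hi => ?_, by rw [hmem, h2]⟩
      have := h.dep_lt
      rw [hd] at this
      have hjk : j < k := WithBot.coe_lt_coe.1 this
      rw [hbuf i (by omega)]
      exact h1 j hd i hi

/-- The source operand `src'` of a store is `src` or its value. -/
def SrcOk (f : R → Option (LVal V L)) (src src' : Operand R V L) : Prop :=
  src' = src ∨ ∃ v, evalOperand f src = some v ∧ src' = .val v

theorem SrcOk.mono {f g : R → Option (LVal V L)} {src src' : Operand R V L}
    (h : SrcOk f src src')
    (hfg : ∀ r, src = .reg r → ∀ v, f r = some v → g r = some v) : SrcOk g src src' := by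
  rcases h with h | ⟨v, hv, h⟩
  · exact .inl h
  · exact .inr ⟨v, evalOperand_mono hfg hv, h⟩

theorem SrcOk.eval_of_val {f : R → Option (LVal V L)} {src : Operand R V L} {v : LVal V L}
    (h : SrcOk f src (.val v)) : evalOperand f src = some v := by
  rcases h with rfl | ⟨w, hw, h⟩
  · rfl
  · cases h
    exact hw

/-- `Refines M C k t₀ t T`: at index `k` of `C`, the entry `t` is a consistent stage of the
execution of the fetched entry `t₀`, and `T` are the labels exposed by resolving it. -/
inductive Refines [Lattice L] [OrderBot L] (M : Machine R V Op) (C : Config R V L Op) (k : ℕ) :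
    Transient R V L Op → Transient R V L Op → Set L → Prop
  | op (r : R) (o : Op) (args : List (Operand R V L)) :
      Refines M C k (.op r o args) (.op r o args) ∅
  | value {r : R} {o : Op} {args : List (Operand R V L)} {vs : List (LVal V L)} {v : V}
      (hvs : EvalArgs (C.resolveReg k) args vs) (hv : M.evalOp o (vs.map LVal.val) = some v) :
      Refines M C k (.op r o args) (.value r ⟨v, joinLab vs⟩) ∅
  | br (o : Op) (args : List (Operand R V L)) (g nT nF : V) :
      Refines M C k (.br o args g nT nF) (.br o args g nT nF) ∅
  | brJump {o : Op} {args : List (Operand R V L)} {g nT nF : V} {vs : List (LVal V L)} {c : Bool}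
      (hvs : EvalArgs (C.resolveReg k) args vs) (hc : M.evalCond o (vs.map LVal.val) = some c)
      -- A resolved jump agrees with the guess of its fetched entry, so the successor recorded in
      -- the chain is the architectural one. After a misprediction the fetched entry is changed to
      -- the corrected guess.
      (hg : (if c then nT else nF) = g) :
      Refines M C k (.br o args g nT nF) (.jump g) {joinLab vs}
  | jmpi (args : List (Operand R V L)) (g : V) :
      Refines M C k (.jmpi args g) (.jmpi args g) ∅
  | jmpiJump {args : List (Operand R V L)} {g : V} {n : LVal V L}
      (hn : EvalAddr M (C.resolveReg k) args n) (hg : n.val = g) :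
      Refines M C k (.jmpi args g) (.jump g) {n.lab}
  | load (r : R) (args : List (Operand R V L)) (pt : V) :
      Refines M C k (.load r args pt) (.load r args pt) ∅
  | loadGuess {r : R} {args : List (Operand R V L)} {v : LVal V L} {j : ℕ} {pt : V} (hj : j < k)
      -- The store may have been retired meanwhile; then index `j` is empty and the condition is
      -- vacuous.
      (hs : ∀ t, C.buf.get j = some t → ∃ dst, t = .store (.val v) dst) :
      Refines M C k (.load r args pt) (.loadGuess r args v j pt) ∅
  | loaded {r : R} {args : List (Operand R V L)} {v a : LVal V L} {dep : WithBot ℕ} {pt : V}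
      (ha : EvalAddr M (C.resolveReg k) args a) (hl : LoadOk C k v dep a.val) :
      Refines M C k (.load r args pt) (.loaded r v dep a.val pt) {a.lab}
  | store {src src' : Operand R V L} {args : List (Operand R V L)}
      (hs : SrcOk (C.resolveReg k) src src') :
      Refines M C k (.store src (.inl args)) (.store src' (.inl args)) ∅
  | storeAddr {src src' : Operand R V L} {args : List (Operand R V L)} {a : LVal V L}
      (hs : SrcOk (C.resolveReg k) src src') (ha : EvalAddr M (C.resolveReg k) args a) :
      Refines M C k (.store src (.inl args)) (.store src' (.inr a)) {a.lab}
  | call : Refines M C k .call .call ∅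
  | ret : Refines M C k .ret .ret ∅
  | fence : Refines M C k .fence .fence ∅

section

variable [Lattice L] [OrderBot L] {M : Machine R V Op} {P : Program R V L Op}
  {C C' : Config R V L Op}

theorem Refines.target_eq {k : ℕ} {t₀ t : Transient R V L Op} {T : Set L}
    (h : Refines M C k t₀ t T) : t.target = t₀.target := by
  cases h <;> rfl

/-- A stage depends on the configuration only through evaluated operands, the source of a resolved
load and the store behind a guess. Only registers among the operands of the fetched entry matter,
which is what allows retirement to forget the temporary register. -/
theorem Refines.mono {k : ℕ} {t₀ t : Transient R V L Op} {T : Set L} (h : Refines M C k t₀ t T)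
    (hreg : ∀ r, .reg r ∈ t₀.operands → ∀ v, C.resolveReg k r = some v →
      C'.resolveReg k r = some v)
    (hload : ∀ r v dep a pt, t = .loaded r v dep a pt → LoadOk C k v dep a →
      LoadOk C' k v dep a)
    (hguess : ∀ j < k, ∀ v : LVal V L,
      (∀ t, C.buf.get j = some t → ∃ dst, t = .store (.val v) dst) →
      ∀ t, C'.buf.get j = some t → ∃ dst, t = .store (.val v) dst) :
    Refines M C' k t₀ t T := by
  cases h with
  | op => exact .op _ _ _
  | value hvs hv => exact .value (hvs.mono hreg) hv
  | br => exact .br _ _ _ _ _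
  | brJump hvs hc hg => exact .brJump (hvs.mono hreg) hc hg
  | jmpi => exact .jmpi _ _
  | jmpiJump hn hg => exact .jmpiJump (hn.mono hreg) hg
  | load => exact .load _ _ _
  | loadGuess hj hs => exact .loadGuess hj (hguess _ hj _ hs)
  | loaded ha hl => exact .loaded (ha.mono hreg) (hload _ _ _ _ _ rfl hl)
  | store hs =>
    exact .store (hs.mono fun r hr => hreg r (by simp [Transient.operands, hr]))
  | storeAddr hs ha =>
    exact .storeAddr (hs.mono fun r hr => hreg r (by simp [Transient.operands, hr]))
      (ha.mono fun r hr => hreg r (by simp [Transient.operands, hr]))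
  | call => exact .call
  | ret => exact .ret
  | fence => exact .fence

theorem Refines.congr {k : ℕ} {t₀ t : Transient R V L Op} {T : Set L} (h : Refines M C k t₀ t T)
    (hreg : C'.reg = C.reg) (hmem : C'.mem = C.mem)
    (hbuf : ∀ j < k, C'.buf.get j = C.buf.get j) : Refines M C' k t₀ t T := by
  refine h.mono ?_ ?_ ?_
  · intro r _ v hv
    rwa [Config.resolveReg_congr hreg hbuf]
  · intro r v dep a pt _ hl
    exact hl.congr hmem hbuf
  · intro j hj v hs
    rwa [hbuf j hj]

/-! ### Instructions in flight -/

/-- The entries `orig` at `i, …, i + len - 1` are those fetched for the instruction at program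
point `n`, with predicted successor `m`. -/
inductive Fetched (M : Machine R V Op) (P : Program R V L Op) (orig : ℕ → Transient R V L Op)
    (i : ℕ) (n : V) : ℕ → V → Prop
  | op {o : Op} {r : R} {args : List (Operand R V L)} {next : V}
      (hP : P n = some (.op o r args next)) (h : orig i = .op r o args) :
      Fetched M P orig i n 1 next
  | br {o : Op} {args : List (Operand R V L)} {nT nF : V} (g : V)
      (hP : P n = some (.br o args nT nF)) (h : orig i = .br o args g nT nF) :
      Fetched M P orig i n 1 g
  | load {r : R} {args : List (Operand R V L)} {next : V}
      (hP : P n = some (.load r args next)) (h : orig i = .load r args n) :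
      Fetched M P orig i n 1 next
  | store {src : Operand R V L} {args : List (Operand R V L)} {next : V}
      (hP : P n = some (.store src args next)) (h : orig i = .store src (.inl args)) :
      Fetched M P orig i n 1 next
  | jmpi {args : List (Operand R V L)} (g : V)
      (hP : P n = some (.jmpi args)) (h : orig i = .jmpi args g) :
      Fetched M P orig i n 1 g
  | call {nf nret : V} (hP : P n = some (.call nf nret)) (h : orig i = .call)
      (h1 : orig (i + 1) = .op M.rsp M.succ [.reg M.rsp])
      (h2 : orig (i + 2) = .store (.val ⟨nret, ⊥⟩) (.inl [.reg M.rsp])) :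
      Fetched M P orig i n 3 nf
  | ret (g : V) (hP : P n = some .ret) (h : orig i = .ret)
      (h1 : orig (i + 1) = .load M.rret [.reg M.rsp] n)
      (h2 : orig (i + 2) = .op M.rsp M.pred [.reg M.rsp])
      (h3 : orig (i + 3) = .jmpi [.reg M.rret] g) :
      Fetched M P orig i n 4 g
  | fence {next : V} (hP : P n = some (.fence next)) (h : orig i = .fence) :
      Fetched M P orig i n 1 next

/-- `Chain M P orig b n e m c`: the entries `orig` at `b, …, e - 1` are those fetched for `c`
consecutive instructions, the first one at program point `n`, continuing at `m`. -/
inductive Chain (M : Machine R V Op) (P : Program R V L Op) (orig : ℕ → Transient R V L Op) :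
    ℕ → V → ℕ → V → ℕ → Prop
  | nil (b : ℕ) (n : V) : Chain M P orig b n b n 0
  | cons {b len e c : ℕ} {n q m : V} (h : Fetched M P orig b n len q)
      (h' : Chain M P orig (b + len) q e m c) : Chain M P orig b n e m (c + 1)

variable {orig orig' : ℕ → Transient R V L Op}

theorem Fetched.len_pos {i len : ℕ} {n m : V} (h : Fetched M P orig i n len m) : 0 < len := by
  cases h <;> omega

theorem Fetched.congr {i len : ℕ} {n m : V} (h : Fetched M P orig i n len m)
    (ho : ∀ k, i ≤ k → k < i + len → orig' k = orig k) : Fetched M P orig' i n len m := by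
  cases h with
  | op hP h => exact .op hP ((ho _ le_rfl (by omega)).trans h)
  | br g hP h => exact .br _ hP ((ho _ le_rfl (by omega)).trans h)
  | load hP h => exact .load hP ((ho _ le_rfl (by omega)).trans h)
  | store hP h => exact .store hP ((ho _ le_rfl (by omega)).trans h)
  | jmpi g hP h => exact .jmpi _ hP ((ho _ le_rfl (by omega)).trans h)
  | call hP h h1 h2 =>
    exact .call hP ((ho _ le_rfl (by omega)).trans h)
      ((ho _ (by omega) (by omega)).trans h1) ((ho _ (by omega) (by omega)).trans h2)
  | ret g hP h h1 h2 h3 =>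
    exact .ret _ hP ((ho _ le_rfl (by omega)).trans h)
      ((ho _ (by omega) (by omega)).trans h1) ((ho _ (by omega) (by omega)).trans h2)
      ((ho _ (by omega) (by omega)).trans h3)
  | fence hP h => exact .fence hP ((ho _ le_rfl (by omega)).trans h)

theorem Chain.le {b e c : ℕ} {n m : V} (h : Chain M P orig b n e m c) : b ≤ e := by
  induction h with
  | nil => exact le_rfl
  | cons _ _ ih => omega

theorem Chain.congr {b e c : ℕ} {n m : V} (h : Chain M P orig b n e m c)
    (ho : ∀ k, b ≤ k → k < e → orig' k = orig k) : Chain M P orig' b n e m c := by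
  induction h with
  | nil => exact .nil _ _
  | cons hf hc ih =>
    have := hc.le
    exact .cons (hf.congr fun k h1 h2 => ho k h1 (by omega))
      (ih fun k h1 h2 => ho k (by omega) h2)

theorem Chain.snoc {b i len c : ℕ} {n p m : V} (h : Chain M P orig b n i p c)
    (hf : Fetched M P orig i p len m) : Chain M P orig b n (i + len) m (c + 1) := by
  induction h with
  | nil => exact .cons hf (.nil _ _)
  | cons hf' _ ih => exact .cons hf' (ih hf)

/-- The instruction of a chain to which a given index belongs. -/
theorem Chain.split {b e c : ℕ} {n m : V} (h : Chain M P orig b n e m c) {i : ℕ} (hb : b ≤ i)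
    (he : i < e) : ∃ s len c₁ c₂ p q, Chain M P orig b n s p c₁ ∧ Fetched M P orig s p len q ∧
      Chain M P orig (s + len) q e m c₂ ∧ s ≤ i ∧ i < s + len ∧ c = c₁ + 1 + c₂ := by
  induction h with
  | nil => omega
  | @cons b len e c n q m hf hc ih =>
    by_cases hi : i < b + len
    · exact ⟨b, len, 0, c, n, q, .nil _ _, hf, hc, hb, hi, by omega⟩
    · obtain ⟨s, len', c₁, c₂, p, q', h1, h2, h3, h4, h5, h6⟩ := ih (by omega) he
      exact ⟨s, len', c₁ + 1, c₂, p, q', .cons hf h1, h2, h3, h4, h5, by omega⟩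

theorem Chain.eq_of_zero {b e : ℕ} {n m : V} (h : Chain M P orig b n e m 0) :
    b = e ∧ n = m := by
  cases h; exact ⟨rfl, rfl⟩

theorem Chain.count_eq_zero {b c : ℕ} {n m : V} (h : Chain M P orig b n b m c) :
    c = 0 ∧ n = m := by
  cases h with
  | nil => exact ⟨rfl, rfl⟩
  | cons hf hc =>
    have := hf.len_pos
    have := hc.le
    omega

/-- The last entry of an instruction is not the marker of a return. -/
theorem Chain.last_ne_ret {b e c : ℕ} {n m : V} (h : Chain M P orig b n e m c) (hbe : b < e) :
    orig (e - 1) ≠ .ret := by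
  induction h with
  | nil => omega
  | @cons b len e c n q m hf hc ih =>
    rcases hc.le.lt_or_eq with hlt | rfl
    · exact ih hlt
    · cases hf <;> simp_all

/-- Only the indirect jump of a return reads the temporary register, and it follows the load of
that register. -/
theorem Chain.exists_load_rret (hP : P.NotRead M.rret) {b e c : ℕ} {n m : V}
    (h : Chain M P orig b n e m c) {k : ℕ} (hb : b ≤ k) (he : k < e)
    (hk : .reg M.rret ∈ (orig k).operands) :
    ∃ j pt, b ≤ j ∧ j < k ∧ orig j = .load M.rret [.reg M.rsp] pt := by
  obtain ⟨s, len, c₁, c₂, p, q, h1, h2, h3, h4, h5, -⟩ := h.split hb he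
  have := h1.le
  have hne := M.rret_ne_rsp
  cases h2 with
  | call hP' ho h1 h2 =>
    obtain rfl | rfl | rfl : k = s ∨ k = s + 1 ∨ k = s + 2 := by omega
    all_goals simp_all [Transient.operands]
  | ret g hP' ho ho1 ho2 ho3 =>
    obtain rfl | rfl | rfl | rfl : k = s ∨ k = s + 1 ∨ k = s + 2 ∨ k = s + 3 := by omega
    · simp_all [Transient.operands]
    · simp_all [Transient.operands]
    · simp_all [Transient.operands]
    · exact ⟨s + 1, p, by omega, by omega, ho1⟩
  -- An instruction with a single entry has exactly the operands written in the program, where the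
  -- temporary register does not occur.
  | _ =>
    obtain rfl : k = s := by omega
    rename_i hP' ho
    rw [ho] at hk
    exact absurd hk (hP _ _ hP')

/-- The instruction of a chain to which a load belongs. -/
theorem Chain.split_load {b e c k : ℕ} {n m : V} (h : Chain M P orig b n e m c) (hb : b ≤ k)
    (he : k < e) {r : R} {args : List (Operand R V L)} {pt : V} (hk : orig k = .load r args pt) :
    ∃ s c₁, Chain M P orig b n s pt c₁ ∧ c₁ < c ∧
      (s = k ∨ s + 1 = k ∧ orig s = .ret) := by
  obtain ⟨s, len, c₁, c₂, p, q, h1, h2, h3, h4, h5, h6⟩ := h.split hb he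
  cases h2 with
  | load hP ho =>
    obtain rfl : k = s := by omega
    cases ho.symm.trans hk
    exact ⟨k, c₁, h1, by omega, .inl rfl⟩
  | call hP' ho h1 h2 =>
    obtain rfl | rfl | rfl : k = s ∨ k = s + 1 ∨ k = s + 2 := by omega
    all_goals simp_all
  | ret g hP' ho ho1 ho2 ho3 =>
    obtain rfl | rfl | rfl | rfl : k = s ∨ k = s + 1 ∨ k = s + 2 ∨ k = s + 3 := by omega
    · simp_all
    · cases ho1.symm.trans hk
      exact ⟨s, c₁, h1, by omega, .inr ⟨rfl, ho⟩⟩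
    · simp_all
    · simp_all
  | _ =>
    obtain rfl : k = s := by omega
    simp_all

/-- A call has a store but no load, a return a load but no store, and every other instruction has
one entry. Hence guessed forwarding and store hazards need two instructions in flight and do not
arise sequentially. -/
theorem Chain.not_load_store_of_single {b e c k j : ℕ} {n m : V}
    (h : Chain M P orig b n e m c) (hc : c ≤ 1) (hbk : b ≤ k) (hke : k < e)
    (hbj : b ≤ j) (hje : j < e) {r : R} {args args' : List (Operand R V L)} {pt : V}
    {src : Operand R V L} (hk : orig k = .load r args pt)
    (hj : orig j = .store src (.inl args')) : False := by
  obtain ⟨s, len, c₁, c₂, p, q, h1, h2, h3, h4, h5, h6⟩ := h.split hbk hke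
  obtain rfl : c₁ = 0 := by omega
  obtain rfl : c₂ = 0 := by omega
  obtain ⟨rfl, -⟩ := h1.eq_of_zero
  obtain ⟨rfl, -⟩ := h3.eq_of_zero
  cases h2 with
  | call hP' ho h1 h2 =>
    obtain rfl | rfl | rfl : k = b ∨ k = b + 1 ∨ k = b + 2 := by omega
    all_goals simp_all
  | ret g hP' ho ho1 ho2 ho3 =>
    obtain rfl | rfl | rfl | rfl : j = b ∨ j = b + 1 ∨ j = b + 2 ∨ j = b + 3 := by omega
    all_goals simp_all
  | _ =>
    obtain rfl : k = b := by omega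
    obtain rfl : j = k := by omega
    simp_all

/-- Redirecting the branch or indirect jump at index `i`. -/
theorem Chain.redirect {b e c i : ℕ} {n m : V} (h : Chain M P orig b n e m c)
    (hb : b ≤ i) (he : i < e) (g' : V) {t₀ : Transient R V L Op}
    (ht : (∃ o args g nT nF, orig i = .br o args g nT nF ∧ t₀ = .br o args g' nT nF) ∨
      (∃ args g, orig i = .jmpi args g ∧ t₀ = .jmpi args g')) :
    ∃ c', Chain M P (Function.update orig i t₀) b n (i + 1) g' c' ∧ c' ≤ c ∧
      (c ≤ 1 → c' = c ∧ i + 1 = e) := by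
  obtain ⟨s, len, c₁, c₂, p, q, h1, h2, h3, h4, h5, h6⟩ := h.split hb he
  -- A branch or indirect jump is the last entry of its instruction, also in a return, so the
  -- redirected instruction ends at `i + 1`.
  have key : len = i + 1 - s ∧ Fetched M P (Function.update orig i t₀) s p len g' := by
    cases h2 with
    | br g hP ho =>
      obtain rfl : i = s := by omega
      rcases ht with ⟨o, args, g, nT, nF, hi, rfl⟩ | ⟨args, g, hi, rfl⟩
      · cases ho.symm.trans hi
        exact ⟨by omega, .br g' hP (by simp)⟩
      · cases ho.symm.trans hi
    | jmpi g hP ho =>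
      obtain rfl : i = s := by omega
      rcases ht with ⟨o, args, g, nT, nF, hi, rfl⟩ | ⟨args, g, hi, rfl⟩
      · cases ho.symm.trans hi
      · cases ho.symm.trans hi
        exact ⟨by omega, .jmpi g' hP (by simp)⟩
    | call hP' ho h1 h2 =>
      obtain rfl | rfl | rfl : i = s ∨ i = s + 1 ∨ i = s + 2 := by omega
      all_goals simp_all
    | ret g hP' ho ho1 ho2 ho3 =>
      obtain rfl | rfl | rfl | rfl : i = s ∨ i = s + 1 ∨ i = s + 2 ∨ i = s + 3 := by omega
      · simp_all
      · simp_all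
      · simp_all
      · rcases ht with ⟨o, args, g, nT, nF, hi, rfl⟩ | ⟨args, g, hi, rfl⟩
        · cases ho3.symm.trans hi
        · cases ho3.symm.trans hi
          refine ⟨by omega, .ret g' hP' ?_ ?_ ?_ (by simp)⟩ <;>
            rw [Function.update_of_ne (by omega)] <;> assumption
    | _ =>
      obtain rfl : i = s := by omega
      simp_all
  refine ⟨c₁ + 1, ?_, by omega, fun hc => ⟨by omega, ?_⟩⟩
  · have := (h1.congr (orig' := Function.update orig i t₀) fun k _ hk =>
      Function.update_of_ne (by omega) _ _).snoc key.2
    rwa [show s + len = i + 1 by omega] at this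
  · obtain rfl : c₂ = 0 := by omega
    obtain ⟨h, -⟩ := h3.eq_of_zero
    omega

end

end

/-! ### Effect of changing one buffer entry, possibly with a rollback. -/

section

variable {R V L Op : Type*}

/-- The labels exposed by the resolved entries at indices `b, …, e - 1`. -/
def pendLabels (lab : ℕ → Set L) (b e : ℕ) : Set L := {l | ∃ k, b ≤ k ∧ k < e ∧ l ∈ lab k}

/-- No load of the buffer has been forwarded a value by a guess. -/
def Config.NoGuess (C : Config R V L Op) : Prop :=
  ∀ k r args v j pt, C.buf.get k ≠ some (.loadGuess r args v j pt)

/-- Changing entry `i` can invalidate an older justification in two ways: a newly known store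
address may belong to a store between source and load (`haddr`), or the source store itself may be
spoiled (`hval`). A source in memory is safe, since the indices up to `dep` are empty and `i` is
not. -/
theorem LoadOk.set {C C' : Config R V L Op} {i k : ℕ} {t t' : Transient R V L Op} {v : LVal V L}
    {dep : WithBot ℕ} {a : V} (h : LoadOk C k v dep a) (hmem : C'.mem = C.mem)
    (hi : C.buf.get i = some t) (hi' : C'.buf.get i = some t')
    (hbuf : ∀ j < k, j ≠ i → C'.buf.get j = C.buf.get j)
    (haddr : i < k → ∀ src b, t' = .store src (.inr b) → b.val = a →
      (i : WithBot ℕ) ≤ dep ∨ ∃ src, t = .store src (.inr b))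
    (hval : i < k → ∀ dst, t = .store (.val v) dst → dep = (i : WithBot ℕ) →
      (∀ b, dst = .inr b → b.val = a) →
      ∃ dst', t' = .store (.val v) dst' ∧ ∀ b, dst' = .inr b → b.val = a) :
    LoadOk C' k v dep a where
  dep_lt := h.dep_lt
  le_dep := by
    rintro j hj ⟨src, b, hs, hb⟩
    by_cases hji : j = i
    · subst hji
      rw [hi'] at hs
      rcases haddr hj src b (Option.some.inj hs) hb with h' | ⟨src', h'⟩
      · exact h'
      · exact h.le_dep j hj ⟨src', b, by rw [hi, h'], hb⟩
    · rw [hbuf j hj hji] at hs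
      exact h.le_dep j hj ⟨src, b, hs, hb⟩
  source := by
    rcases h.source with ⟨j, dst, hd, hj, hb⟩ | ⟨h1, h2⟩
    · have hjk : j < k := by
        have := h.dep_lt
        rw [hd] at this
        exact WithBot.coe_lt_coe.1 this
      by_cases hji : j = i
      · subst hji
        rw [hi] at hj
        obtain ⟨dst', h1, h2⟩ := hval hjk dst (Option.some.inj hj) hd hb
        exact .inl ⟨j, dst', hd, by rw [hi', h1], h2⟩
      · exact .inl ⟨j, dst, hd, by rw [hbuf j hjk hji, hj], hb⟩
    · refine .inr ⟨fun j hd i' hi'' => ?_, by rw [hmem, h2]⟩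
      have hjk : j < k := by
        have := h.dep_lt
        rw [hd] at this
        exact WithBot.coe_lt_coe.1 this
      have hn := h1 j hd i' hi''
      have hne : i' ≠ i := by
        rintro rfl
        rw [hi] at hn
        cases hn
      rw [hbuf i' (by omega) hne, hn]

/-- Absence of a hazard is exactly what is required: if the addresses agree, the store is not
younger than the source, and if the store is the source, the addresses agree. -/
theorem LoadOk.set_storeAddr {C C' : Config R V L Op} {i k : ℕ}
    {src : Operand R V L} {args : List (Operand R V L)} {a v : LVal V L}
    {dep : WithBot ℕ} {b' pt : V} {r : R}
    (hi : C.buf.get i = some (.store src (.inl args))) (hmem : C'.mem = C.mem)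
    (hi' : C'.buf.get i = some (.store src (.inr a)))
    (hbuf : ∀ j < k, j ≠ i → C'.buf.get j = C.buf.get j) (hik : i < k)
    (hk : C.buf.get k = some (.loaded r v dep b' pt)) (hz : ¬ C.Hazard i a.val k)
    (hl : LoadOk C k v dep b') : LoadOk C' k v dep b' := by
  have hz' : ¬ ((b' = a.val ∧ dep < (i : WithBot ℕ)) ∨ (dep = (i : WithBot ℕ) ∧ b' ≠ a.val)) :=
    fun h => hz ⟨hik, r, v, dep, b', pt, hk, h⟩
  rw [not_or, not_and, not_and, not_lt, not_not] at hz'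
  refine hl.set hmem hi hi' hbuf ?_ ?_
  · intro _ src' b₁ h hb
    cases h
    exact .inl (hz'.1 hb.symm)
  · intro _ dst h hd _
    cases h
    refine ⟨_, rfl, ?_⟩
    intro b₁ h
    cases h
    exact (hz'.2 hd).symm

theorem Config.NoGuess.of_forall {C C' : Config R V L Op} {i : ℕ} (h : C.NoGuess)
    (hbuf : ∀ k ≠ i, C'.buf.get k = C.buf.get k ∨ C'.buf.get k = none)
    (hi : ∀ r args v j pt, C'.buf.get i ≠ some (.loadGuess r args v j pt)) : C'.NoGuess := by
  intro k r args v j pt hk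
  by_cases hki : k = i
  · subst hki
    exact hi _ _ _ _ _ hk
  · rcases hbuf k hki with h' | h' <;> rw [h'] at hk
    · exact h _ _ _ _ _ _ hk
    · cases hk

section

variable [Lattice L] [OrderBot L] {M : Machine R V Op} {P : Program R V L Op}
  {C C' : Config R V L Op} {orig orig' : ℕ → Transient R V L Op} {lab : ℕ → Set L}

/-- The invariant of configurations: the reorder buffer occupies the indices `b, …, e - 1` and
holds `c` instructions, the oldest one at program point `n`, in consistent stages of execution. -/
structure Inv (M : Machine R V Op) (P : Program R V L Op) (C : Config R V L Op)
    (orig : ℕ → Transient R V L Op) (lab : ℕ → Set L) (b : ℕ) (n : V) (e c : ℕ) : Prop where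
  chain : Chain M P orig b n e C.pc c
  entry : ∀ k, b ≤ k → k < e → ∃ t, C.buf.get k = some t ∧ Refines M C k (orig k) t (lab k)
  outside : ∀ k, C.buf.get k ≠ none → b ≤ k ∧ k < e

/-- What the execution of a buffer entry with observations `O` preserves. -/
def ExecPost (M : Machine R V Op) (P : Program R V L Op) (C C' : Config R V L Op)
    (O : List (Obs V L)) (lab : ℕ → Set L) (b : ℕ) (n : V) (e c : ℕ) : Prop :=
  ∃ orig' lab' e' c', Inv M P C' orig' lab' b n e' c' ∧ C'.reg = C.reg ∧ C'.mem = C.mem ∧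
    c' ≤ c ∧ pendLabels lab' b e' ⊆ pendLabels lab b e ∪ obsLabels O ∧
    -- The clause for sequential executions. With one instruction in flight and no guessed load, no
    -- exposed label is lost, so every observed label stays pending until retirement.
    (c ≤ 1 → C.NoGuess → c' = c ∧ C'.NoGuess ∧
      obsLabels O ∪ pendLabels lab b e ⊆ pendLabels lab' b e')

variable {b e c i : ℕ} {n : V}

theorem Inv.exists_refines (hI : Inv M P C orig lab b n e c) {t : Transient R V L Op}
    (hi : C.buf.get i = some t) : b ≤ i ∧ i < e ∧ Refines M C i (orig i) t (lab i) := by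
  obtain ⟨h1, h2⟩ := hI.outside i (by simp [hi])
  obtain ⟨t', h3, h4⟩ := hI.entry i h1 h2
  cases hi.symm.trans h3
  exact ⟨h1, h2, h4⟩

/-- Changing the entry at index `i` and dropping the entries from `e'` on. -/
theorem Inv.update (hI : Inv M P C orig lab b n e c) {t t' : Transient R V L Op} {e' c' : ℕ}
    {T' : Set L} (hi : C.buf.get i = some t) (hi' : C'.buf.get i = some t') (hie : i < e')
    (hee : e' ≤ e) (hreg : C'.reg = C.reg) (hmem : C'.mem = C.mem)
    (hbuf : ∀ k < e', k ≠ i → C'.buf.get k = C.buf.get k)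
    (hnone : ∀ k, e' ≤ k → C'.buf.get k = none)
    (hchain : Chain M P orig' b n e' C'.pc c') (horig : ∀ k ≠ i, orig' k = orig k)
    (href : Refines M C i (orig' i) t' T') (htar : t'.target = t.target)
    (hres : ∀ v, t.result = some v → t'.result = some v)
    (hguess : ∀ v dst, t = .store (.val v) dst → ∃ dst', t' = .store (.val v) dst')
    (hload : ∀ k, i < k → k < e' → ∀ r v dep a pt, C.buf.get k = some (.loaded r v dep a pt) →
      LoadOk C k v dep a → LoadOk C' k v dep a) :
    Inv M P C' orig' (Function.update lab i T') b n e' c' where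
  chain := hchain
  outside := fun k hk => by
    have hke : k < e' := by
      by_contra h
      exact hk (hnone k (by omega))
    by_cases hki : k = i
    · subst hki
      exact ⟨(hI.outside k (by simp [hi])).1, hke⟩
    · rw [hbuf k hke hki] at hk
      exact ⟨(hI.outside k hk).1, hke⟩
  entry := fun k hbk hke => by
    by_cases hki : k = i
    · subst hki
      refine ⟨t', hi', ?_⟩
      rw [Function.update_self]
      exact href.congr hreg hmem fun j hj => hbuf j (by omega) (by omega)
    · obtain ⟨tk, h1, h2⟩ := hI.entry k hbk (by omega)
      refine ⟨tk, by rw [hbuf k hke hki, h1], ?_⟩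
      rw [Function.update_of_ne hki, horig k hki]
      rcases lt_or_gt_of_ne hki with hlt | hlt
      · exact h2.congr hreg hmem fun j hj => hbuf j (by omega) (by omega)
      -- A younger entry sees the target register, the result and, for loads, the store at index
      -- `i`. The target stays the same and a result may become available but never changes.
      refine h2.mono ?_ ?_ ?_
      · intro r _ v hv
        refine Config.resolveReg_mono (Nat.zero_le k) ?_ ?_ ?_ hv
        · intro _ w hw
          rwa [Config.resolveReg_zero, hreg, ← Config.resolveReg_zero]
        · intro j _ hj
          by_cases hji : j = i
          · subst hji
            simp only [Config.Assigns, hi, hi', Option.some.injEq, exists_eq_left', htar]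
          · simp only [Config.Assigns, hbuf j (by omega) hji]
        · intro j _ hj w hw
          by_cases hji : j = i
          · subst hji
            rw [hi] at hw
            rw [hi']
            exact hres w hw
          · rwa [hbuf j (by omega) hji]
      · rintro r v dep a pt rfl hl
        exact hload k hlt hke r v dep a pt h1 hl
      · intro j hj v hs u hu
        by_cases hji : j = i
        · subst hji
          obtain ⟨dst, hdst⟩ := hs t hi
          obtain ⟨dst', hdst'⟩ := hguess v dst hdst
          cases hi'.symm.trans hu
          exact ⟨dst', hdst'⟩
        · rw [hbuf j (by omega) hji] at hu
          exact hs u hu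

/-- The labels observed in the step are charged to entry `i`, so a pending label is either old or
observed. If no entries are cut off, no label disappears and the converse inclusion holds as well.
-/
theorem ExecPost.of_update (hI : Inv M P C orig lab b n e c) {t t' : Transient R V L Op}
    {e' c' : ℕ} {O : List (Obs V L)} (hi : C.buf.get i = some t) (hi' : C'.buf.get i = some t')
    (hie : i < e') (hee : e' ≤ e) (hreg : C'.reg = C.reg) (hmem : C'.mem = C.mem)
    (hbuf : ∀ k < e', k ≠ i → C'.buf.get k = C.buf.get k)
    (hnone : ∀ k, e' ≤ k → C'.buf.get k = none)
    (hchain : Chain M P orig' b n e' C'.pc c') (horig : ∀ k ≠ i, orig' k = orig k)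
    (href : Refines M C i (orig' i) t' (lab i ∪ obsLabels O)) (htar : t'.target = t.target)
    (hres : ∀ v, t.result = some v → t'.result = some v)
    (hguess : ∀ v dst, t = .store (.val v) dst → ∃ dst', t' = .store (.val v) dst')
    (hload : ∀ k, i < k → k < e' → ∀ r v dep a pt, C.buf.get k = some (.loaded r v dep a pt) →
      LoadOk C k v dep a → LoadOk C' k v dep a) (hc : c' ≤ c)
    (hseq : c ≤ 1 → C.NoGuess → c' = c ∧ e' = e ∧
      ∀ r args v j pt, t' ≠ .loadGuess r args v j pt) :
    ExecPost M P C C' O lab b n e c := by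
  refine ⟨orig', _, e', c', hI.update hi hi' hie hee hreg hmem hbuf hnone hchain horig href htar
    hres hguess hload, hreg, hmem, hc, ?_, ?_⟩
  · rintro l ⟨k, hbk, hke, hl⟩
    by_cases hki : k = i
    · subst hki
      rw [Function.update_self] at hl
      exact hl.imp_left fun hl => ⟨k, hbk, by omega, hl⟩
    · rw [Function.update_of_ne hki] at hl
      exact .inl ⟨k, hbk, by omega, hl⟩
  · intro hc1 hng
    obtain ⟨h1, rfl, h2⟩ := hseq hc1 hng
    refine ⟨h1, Config.NoGuess.of_forall (i := i) hng (fun k hk => ?_) ?_, ?_⟩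
    · by_cases hke : k < e'
      · exact .inl (hbuf k hke hk)
      · exact .inr (hnone k (by omega))
    · intro r args v j pt h
      exact h2 r args v j pt (Option.some.inj (hi'.symm.trans h))
    · have hbi := (hI.outside i (by simp [hi])).1
      rintro l (hl | ⟨k, hbk, hke, hl⟩)
      · refine ⟨i, hbi, hie, ?_⟩
        rw [Function.update_self]
        exact .inr hl
      · refine ⟨k, hbk, hke, ?_⟩
        by_cases hki : k = i
        · subst hki
          rw [Function.update_self]
          exact .inl hl
        · rwa [Function.update_of_ne hki]

/-- Replacing a single entry. -/
theorem ExecPost.setBuf (hI : Inv M P C orig lab b n e c) {t t' : Transient R V L Op}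
    {O : List (Obs V L)} (hi : C.buf.get i = some t)
    (href : Refines M C i (orig i) t' (lab i ∪ obsLabels O)) (htar : t'.target = t.target)
    (hres : ∀ v, t.result = some v → t'.result = some v)
    (hguess : ∀ v dst, t = .store (.val v) dst → ∃ dst', t' = .store (.val v) dst')
    (hload : ∀ k, i < k → ∀ r v dep a pt, C.buf.get k = some (.loaded r v dep a pt) →
      LoadOk C k v dep a → LoadOk (C.setBuf i t') k v dep a)
    (hseq : c ≤ 1 → C.NoGuess → ∀ r args v j pt, t' ≠ .loadGuess r args v j pt) :
    ExecPost M P C (C.setBuf i t') O lab b n e c := by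
  obtain ⟨h1, h2, -⟩ := hI.exists_refines hi
  refine .of_update (e' := e) (c' := c) hI hi (t' := t') (FMap.get_set_self _ _ _) h2 le_rfl rfl
    rfl (fun k _ hk => FMap.get_set_of_ne _ _ hk) (fun k hk => ?_) hI.chain (fun _ _ => rfl) href
    htar hres hguess (fun k hk _ => hload k hk) le_rfl (fun a b => ⟨rfl, rfl, hseq a b⟩)
  change (C.buf.set i t').get k = none
  rw [FMap.get_set_of_ne _ _ (by omega)]
  by_contra h
  exact absurd (hI.outside k h).2 (by omega)

/-- Replacing a single entry that is not a store. -/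
theorem ExecPost.setBuf_of_not_store (hI : Inv M P C orig lab b n e c)
    {t t' : Transient R V L Op} {O : List (Obs V L)} (hi : C.buf.get i = some t)
    (href : Refines M C i (orig i) t' (lab i ∪ obsLabels O)) (htar : t'.target = t.target)
    (hres : ∀ v, t.result = some v → t'.result = some v)
    (ht : ∀ src dst, t ≠ .store src dst) (ht' : ∀ src dst, t' ≠ .store src dst)
    (hseq : c ≤ 1 → C.NoGuess → ∀ r args v j pt, t' ≠ .loadGuess r args v j pt) :
    ExecPost M P C (C.setBuf i t') O lab b n e c := by
  refine .setBuf hI hi href htar hres (fun v dst h => absurd h (ht _ _)) ?_ hseq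
  intro k _ r v dep a pt _ hl
  refine hl.set rfl hi (t' := t') (FMap.get_set_self _ _ _)
    (fun j _ hj => FMap.get_set_of_ne _ _ hj) ?_ ?_
  · intro _ src b h
    exact absurd h (ht' _ _)
  · intro _ dst h
    exact absurd h (ht _ _)

/-- Correcting a mispredicted branch or indirect jump. -/
theorem ExecPost.redirect (hI : Inv M P C orig lab b n e c) {t t₀ : Transient R V L Op}
    {O : List (Obs V L)} {m : V} (hi : C.buf.get i = some t)
    (ht₀ : (∃ o args g nT nF, orig i = .br o args g nT nF ∧ t₀ = .br o args m nT nF) ∨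
      (∃ args g, orig i = .jmpi args g ∧ t₀ = .jmpi args m))
    (href : Refines M C i t₀ (.jump m) (lab i ∪ obsLabels O)) (htar : t.target = none)
    (hres : t.result = none) (ht : ∀ src dst, t ≠ .store src dst) :
    ExecPost M P C ((C.rollback i m).setBuf i (.jump m)) O lab b n e c := by
  obtain ⟨h1, h2, -⟩ := hI.exists_refines hi
  obtain ⟨c', h3, h4, h5⟩ := hI.chain.redirect h1 h2 m ht₀
  have hset : ((C.rollback i m).setBuf i (.jump m)).buf.get i = some (.jump m) :=
    FMap.get_set_self _ _ _
  have hbuf : ∀ k, k ≠ i → ((C.rollback i m).setBuf i (.jump m)).buf.get k =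
      if k < i then C.buf.get k else none := fun k hk => by
    change ((C.buf.below i).set i (.jump m)).get k = _
    rw [FMap.get_set_of_ne _ _ hk, FMap.get_below]
  refine .of_update (e' := i + 1) hI hi hset (Nat.lt_succ_self i) h2 rfl rfl ?_ ?_ h3
    (fun k hk => Function.update_of_ne hk _ _) (by rwa [Function.update_self]) (by rw [htar]; rfl)
    (by simp [hres]) (fun v dst h => absurd h (ht _ _)) (fun k h h' => by omega) h4
    (fun hc _ => ⟨(h5 hc).1, (h5 hc).2, by simp⟩)
  · intro k hk hki
    rw [hbuf k hki, if_pos (by omega)]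
  · intro k hk
    rw [hbuf k (by omega), if_neg (by omega)]

/-- The first index of the instruction of a load. -/
theorem Inv.loadStart (hI : Inv M P C orig lab b n e c) {k : ℕ} (hb : b ≤ k) (he : k < e)
    {r : R} {args : List (Operand R V L)} {pt : V} (hk : orig k = .load r args pt) :
    ∃ c', Chain M P orig b n (C.loadStart k) pt c' ∧ c' ≤ c ∧ C.loadStart k ≤ k ∧
      ∀ i < k, orig i ≠ .ret → i < C.loadStart k := by
  obtain ⟨s, c', h1, h2, h3⟩ := hI.chain.split_load hb he hk
  have hret : ∀ j, b ≤ j → j < e → (C.buf.get j = some .ret ↔ orig j = .ret) := by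
    intro j hj hj'
    obtain ⟨t, h4, h5⟩ := hI.entry j hj hj'
    rw [h4]
    generalize orig j = t₀ at h5
    generalize lab j = T at h5
    constructor
    · rintro ⟨⟩
      cases h5
      rfl
    · rintro rfl
      cases h5
      rfl
  have hle := h1.le
  have hs : C.loadStart k = s := by
    unfold Config.loadStart
    rcases h3 with rfl | ⟨rfl, h3⟩
    · refine if_neg fun h => ?_
      have h4 := hI.outside (s - 1) (by simp [h])
      have h5 := (hret _ h4.1 h4.2).1 h
      rcases hle.lt_or_eq with hlt | rfl
      · exact h1.last_ne_ret hlt h5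
      -- The load is the oldest entry. If `b = 0`, truncated subtraction makes the inspected index
      -- that of the load itself, which is not a marker; otherwise the inspected index lies outside
      -- the buffer.
      · obtain rfl | hpos := Nat.eq_zero_or_pos b
        · rw [hk] at h5
          cases h5
        · omega
    · exact if_pos ((hret _ (by omega) (by omega)).2 h3)
  rw [hs]
  refine ⟨c', h1, h2.le, by omega, ?_⟩
  intro i hi hne
  rcases h3 with rfl | ⟨rfl, h3⟩
  · exact hi
  · have : i ≠ s := by
      rintro rfl
      exact hne h3
    omega

/-- Fetching again a load that has been forwarded the wrong value. -/
theorem ExecPost.rollback (hI : Inv M P C orig lab b n e c) {O : List (Obs V L)} {r : R}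
    {args : List (Operand R V L)} {v : LVal V L} {j : ℕ} {pt : V}
    (hi : C.buf.get i = some (.loadGuess r args v j pt)) :
    ExecPost M P C (C.rollback (C.loadStart i) pt) O lab b n e c := by
  obtain ⟨h1, h2, h3⟩ := hI.exists_refines hi
  have ho : orig i = .load r args pt := by
    generalize orig i = t₀ at h3
    generalize lab i = T at h3
    cases h3; rfl
  obtain ⟨c', h4, h5, h6, -⟩ := hI.loadStart h1 h2 ho
  have hbuf : ∀ k, (C.rollback (C.loadStart i) pt).buf.get k =
      if k < C.loadStart i then C.buf.get k else none := fun k => FMap.get_below _ _ _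
  refine ⟨orig, lab, _, c', ⟨h4, ?_, ?_⟩, rfl, rfl, h5,
    fun l ⟨k, h7, h8, h9⟩ => .inl ⟨k, h7, by omega, h9⟩,
    -- This rollback starts from a guessed load, so the sequential clause is vacuous.
    fun _ hng => absurd hi (hng _ _ _ _ _ _)⟩
  · intro k hbk hk
    obtain ⟨t, h7, h8⟩ := hI.entry k hbk (by omega)
    refine ⟨t, by rw [hbuf, if_pos hk, h7], h8.congr rfl rfl fun j hj => ?_⟩
    rw [hbuf, if_pos (by omega)]
  · intro k hk
    rw [hbuf] at hk
    split_ifs at hk with h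
    · exact ⟨(hI.outside k hk).1, h⟩
    · exact absurd rfl hk

end

end

/-! ### Execute directives preserve the invariant. -/

section

variable {R V L Op : Type*} [Lattice L] [OrderBot L] {M : Machine R V Op}
  {P : Program R V L Op} {C C' : Config R V L Op} {orig : ℕ → Transient R V L Op}
  {lab : ℕ → Set L} {b e c : ℕ} {n : V}

/-- A value that was already resolved resolves to itself, so loads that took it remain justified. -/
theorem ExecPost.storeValue (hI : Inv M P C orig lab b n e c) {i : ℕ} {src : Operand R V L}
    {dst : List (Operand R V L) ⊕ LVal V L} {v : LVal V L}
    (hi : C.buf.get i = some (.store src dst)) (hv : C.resolve i src = some v) :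
    ExecPost M P C (C.setBuf i (.store (.val v) dst)) [] lab b n e c := by
  obtain ⟨-, -, h3⟩ := hI.exists_refines hi
  rw [Config.resolve_eq] at hv
  have hsrc : ∀ src₀, SrcOk (C.resolveReg i) src₀ src → SrcOk (C.resolveReg i) src₀ (.val v) := by
    rintro src₀ (rfl | ⟨w, hw, rfl⟩)
    · exact .inr ⟨v, hv, rfl⟩
    · cases hv
      exact .inr ⟨_, hw, rfl⟩
  refine .setBuf hI hi ?_ rfl (fun w h => by cases h) ?_ ?_ (fun _ _ => by simp)
  · rw [obsLabels_nil, Set.union_empty]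
    generalize orig i = t₀ at h3 ⊢
    generalize lab i = T at h3 ⊢
    cases h3 with
    | store hs => exact .store (hsrc _ hs)
    | storeAddr hs ha => exact .storeAddr (hsrc _ hs) ha
  · intro w dst' h
    cases h
    cases hv
    exact ⟨_, rfl⟩
  · intro k _ r w dep a pt _ hl
    refine hl.set rfl hi (t' := .store (.val v) dst) (FMap.get_set_self _ _ _)
      (fun j _ hj => FMap.get_set_of_ne _ _ hj) ?_ ?_
    · intro _ src' b' h _
      cases h
      exact .inr ⟨_, rfl⟩
    · intro _ dst' h _ hb
      cases h
      cases hv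
      exact ⟨_, rfl, hb⟩

theorem ExecPost.storeAddr (hI : Inv M P C orig lab b n e c) {i : ℕ} {src : Operand R V L}
    {args : List (Operand R V L)} {a : LVal V L}
    (hi : C.buf.get i = some (.store src (.inl args))) (ha : C.ResolvesAddr M i args a)
    (hk : ∀ k, ¬ C.Hazard i a.val k) :
    ExecPost M P C (C.setBuf i (.store src (.inr a))) [.fwd a] lab b n e c := by
  obtain ⟨-, -, h3⟩ := hI.exists_refines hi
  rw [Config.resolvesAddr_iff] at ha
  refine .setBuf hI hi ?_ rfl (fun w h => by cases h) ?_ ?_ (fun _ _ => by simp)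
  · rw [obsLabels_fwd]
    generalize orig i = t₀ at h3 ⊢
    generalize lab i = T at h3 ⊢
    cases h3 with
    | store hs =>
      rw [Set.empty_union]
      exact .storeAddr hs ha
  · intro w dst' h
    cases h
    exact ⟨_, rfl⟩
  · intro k hik r w dep b' pt hk' hl
    exact hl.set_storeAddr hi rfl (FMap.get_set_self _ _ _)
      (fun j _ hj => FMap.get_set_of_ne _ _ hj) hik hk' (hk k)

/-- The rollback starts at the instruction of the least hazardous load, so no surviving load is
hazardous and the argument of `LoadOk.set_storeAddr` applies to each of them. The store survives
too: the only entry that can be removed in front of that load is the marker of a return. -/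
theorem ExecPost.storeHazard (hI : Inv M P C orig lab b n e c) {i k : ℕ} {src : Operand R V L}
    {args : List (Operand R V L)} {a : LVal V L} {r : R} {v : LVal V L} {dep : WithBot ℕ}
    {b' pt : V}
    (hi : C.buf.get i = some (.store src (.inl args))) (ha : C.ResolvesAddr M i args a)
    (hk : IsLeast {k | C.Hazard i a.val k} k)
    (hload : C.buf.get k = some (.loaded r v dep b' pt)) :
    ExecPost M P C ((C.rollback (C.loadStart k) pt).setBuf i (.store src (.inr a)))
      [.rollback, .fwd a] lab b n e c := by
  obtain ⟨h1, h2, h3⟩ := hI.exists_refines hi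
  obtain ⟨h4, h5, h6⟩ := hI.exists_refines hload
  rw [Config.resolvesAddr_iff] at ha
  have hik : i < k := hk.1.1
  obtain ⟨args', hok⟩ : ∃ args', orig k = .load r args' pt := by
    generalize orig k = t₀ at h6
    generalize lab k = T at h6
    cases h6
    exact ⟨_, rfl⟩
  obtain ⟨src₀, hoi, hs, hT⟩ : ∃ src₀, orig i = .store src₀ (.inl args) ∧
      SrcOk (C.resolveReg i) src₀ src ∧ lab i = ∅ := by
    generalize orig i = t₀ at h3
    generalize lab i = T at h3
    cases h3 with
    | store hs => exact ⟨_, rfl, hs, rfl⟩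
  obtain ⟨c', h7, h8, h9, h10⟩ := hI.loadStart h4 h5 hok
  have his : i < C.loadStart k := h10 i hik (by simp [hoi])
  have hbuf : ∀ j, j ≠ i → ((C.rollback (C.loadStart k) pt).setBuf i
      (.store src (.inr a))).buf.get j = if j < C.loadStart k then C.buf.get j else none := by
    intro j hj
    change ((C.buf.below _).set i _).get j = _
    rw [FMap.get_set_of_ne _ _ hj, FMap.get_below]
  refine .of_update (e' := C.loadStart k) (c' := c') (orig' := orig) hI hi
    (t' := .store src (.inr a)) (FMap.get_set_self _ _ _) his (by omega) rfl rfl ?_ ?_ h7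
    (fun _ _ => rfl) ?_ rfl (fun w h => by cases h) ?_ ?_ h8 ?_
  · intro j hj hji
    rw [hbuf j hji, if_pos hj]
  · intro j hj
    rw [hbuf j (by omega), if_neg (by omega)]
  · rw [obsLabels_rollback, obsLabels_fwd, hoi, hT, Set.empty_union]
    exact .storeAddr hs ha
  · intro w dst' h
    cases h
    exact ⟨_, rfl⟩
  · intro j hij hj r' w dep' b₁ pt' hj' hl
    refine hl.set_storeAddr hi rfl (FMap.get_set_self _ _ _) (fun m hm hmi => ?_) hij hj' ?_
    · rw [hbuf m hmi, if_pos (by omega)]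
    · intro hz
      have := hk.2 hz
      omega
  · intro hc _
    exact (hI.chain.not_load_store_of_single hc h4 h5 h1 h2 hok hoi).elim

/-- Apart from the rollbacks of guessed loads, every rule moves one entry to a later or equal stage
of `Refines`, and the labels it emits are those by which the label set of that entry grows. -/
theorem Step.execPost [DecidableEq R] [DecidableEq V] {d : Directive V} {O : List (Obs V L)}
    (h : Step M P C d O C') (hd : d.isFetch = false) (hd' : d.isRetire = false)
    (hI : Inv M P C orig lab b n e c) : ExecPost M P C C' O lab b n e c := by
  cases h with
  | op_fetch | load_fetch | store_fetch | fence_fetch | br_fetch | jmpi_fetch | call_fetch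
  | ret_fetch_rsb | ret_fetch_rsb_empty => cases hd
  | value_retire | jump_retire | fence_retire | store_retire | call_retire | ret_retire =>
    cases hd'
  | op_execute i r o args vs v hi hfence hvs hv =>
    obtain ⟨-, -, h3⟩ := hI.exists_refines hi
    rw [Config.resolves_iff] at hvs
    refine .setBuf_of_not_store hI hi ?_ rfl (by simp [Transient.result]) (by simp) (by simp)
      (by simp)
    generalize orig i = t₀ at h3 ⊢
    generalize lab i = T at h3 ⊢
    cases h3
    simpa using .value hvs hv
  | br_execute_correct i o args guess nT nF vs c hi hfence hvs hb hguess =>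
    obtain ⟨-, -, h3⟩ := hI.exists_refines hi
    rw [Config.resolves_iff] at hvs
    refine .setBuf_of_not_store hI hi ?_ rfl (by simp [Transient.result]) (by simp) (by simp)
      (by simp)
    generalize orig i = t₀ at h3 ⊢
    generalize lab i = T at h3 ⊢
    cases h3
    simpa using .brJump hvs hb hguess
  | br_execute_incorrect i o args guess nT nF vs c m hi hfence hvs hb hn hguess =>
    obtain ⟨-, -, h3⟩ := hI.exists_refines hi
    rw [Config.resolves_iff] at hvs
    obtain ⟨ho, hT⟩ : orig i = .br o args guess nT nF ∧ lab i = ∅ := by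
      generalize orig i = t₀ at h3 ⊢
      generalize lab i = T at h3 ⊢
      cases h3
      exact ⟨rfl, rfl⟩
    refine .redirect hI hi (.inl ⟨_, _, _, _, _, ho, rfl⟩) ?_ rfl rfl (by simp)
    rw [hT]
    simpa using .brJump hvs hb hn
  | jmpi_execute_correct i args guess m hi hfence hn hguess =>
    obtain ⟨-, -, h3⟩ := hI.exists_refines hi
    rw [Config.resolvesAddr_iff] at hn
    refine .setBuf_of_not_store hI hi ?_ rfl (by simp [Transient.result]) (by simp) (by simp)
      (by simp)
    generalize orig i = t₀ at h3 ⊢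
    generalize lab i = T at h3 ⊢
    cases h3
    simpa using .jmpiJump hn hguess
  | jmpi_execute_incorrect i args guess m hi hfence hn hguess =>
    obtain ⟨-, -, h3⟩ := hI.exists_refines hi
    rw [Config.resolvesAddr_iff] at hn
    obtain ⟨ho, hT⟩ : orig i = .jmpi args guess ∧ lab i = ∅ := by
      generalize orig i = t₀ at h3 ⊢
      generalize lab i = T at h3 ⊢
      cases h3
      exact ⟨rfl, rfl⟩
    refine .redirect hI hi (.inr ⟨_, _, ho, rfl⟩) ?_ rfl rfl (by simp)
    rw [hT]
    simpa using .jmpiJump hn rfl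
  | load_execute_forward i j r args pt a b' v hi hfence ha hj hv =>
    obtain ⟨-, -, h3⟩ := hI.exists_refines hi
    rw [Config.resolvesAddr_iff] at ha
    refine .setBuf_of_not_store hI hi ?_ rfl (by simp [Transient.result]) (by simp) (by simp)
      (by simp)
    generalize orig i = t₀ at h3 ⊢
    generalize lab i = T at h3 ⊢
    cases h3
    have hl : LoadOk C i v (j : WithBot ℕ) a.val := by
      refine ⟨WithBot.coe_lt_coe.2 hj.1.1, fun k hk hs => WithBot.coe_le_coe.2 (hj.2 ⟨hk, hs⟩),
        .inl ⟨j, _, rfl, hv, ?_⟩⟩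
      intro b₁ h
      obtain ⟨src, b₂, h1, h2⟩ := hj.1.2
      cases hv.symm.trans h1
      cases h
      exact h2
    simpa using .loaded ha hl
  | load_execute_nodep i r args pt a v hi hfence ha hj hv =>
    obtain ⟨-, -, h3⟩ := hI.exists_refines hi
    rw [Config.resolvesAddr_iff] at ha
    refine .setBuf_of_not_store hI hi ?_ rfl (by simp [Transient.result]) (by simp) (by simp)
      (by simp)
    generalize orig i = t₀ at h3 ⊢
    generalize lab i = T at h3 ⊢
    cases h3
    -- With `dep = ⊥` the bound on earlier stores holds because there are none with this address,
    -- and no index equals `dep`.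
    have hl : LoadOk C i v ⊥ a.val :=
      ⟨WithBot.bot_lt_coe _, fun k hk hs => absurd hs (hj k hk),
        .inr ⟨fun j h => absurd h.symm (WithBot.coe_ne_bot), hv⟩⟩
    simpa using .loaded ha hl
  | load_execute_guess i j r args pt v dst hi hfence hji hj =>
    obtain ⟨h1, h2, h3⟩ := hI.exists_refines hi
    obtain ⟨h4, h5, h6⟩ := hI.exists_refines hj
    obtain ⟨ho, hT⟩ : orig i = .load r args pt ∧ lab i = ∅ := by
      generalize orig i = t₀ at h3 ⊢
      generalize lab i = T at h3 ⊢
      cases h3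
      exact ⟨rfl, rfl⟩
    refine .setBuf_of_not_store hI hi ?_ rfl (by simp [Transient.result]) (by simp) (by simp) ?_
    · rw [ho, hT, obsLabels_nil, Set.union_empty]
      refine .loadGuess hji ?_
      intro t ht
      cases hj.symm.trans ht
      exact ⟨_, rfl⟩
    · intro hc _
      obtain ⟨src, args', hoj⟩ : ∃ src args', orig j = .store src (.inl args') := by
        generalize orig j = t₀ at h6 ⊢
        generalize lab j = T at h6
        cases h6 <;> exact ⟨_, _, rfl⟩
      exact (hI.chain.not_load_store_of_single hc h1 h2 h4 h5 ho hoj).elim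
  | load_execute_addr_ok i j r args pt a v dst hi hfence ha hj hdst hk =>
    obtain ⟨-, -, h3⟩ := hI.exists_refines hi
    rw [Config.resolvesAddr_iff] at ha
    refine .setBuf_of_not_store hI hi ?_ rfl (by simp [Transient.result]) (by simp) (by simp)
      (by simp)
    generalize orig i = t₀ at h3 ⊢
    generalize lab i = T at h3 ⊢
    cases h3 with
    | loadGuess hji hs =>
      have hl : LoadOk C i v (j : WithBot ℕ) a.val := by
        refine ⟨WithBot.coe_lt_coe.2 hji, fun k hk' hs => WithBot.coe_le_coe.2 ?_,
          .inl ⟨j, _, rfl, hj, hdst⟩⟩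
        exact not_lt.1 fun hlt => hk k hlt hk' hs
      simpa using .loaded ha hl
  | load_execute_addr_hazard i j r args pt a v hi hfence ha hj => exact .rollback hI hi
  | load_execute_mem_match i j r args pt a v hi hfence ha hj hk hv =>
    obtain ⟨-, -, h3⟩ := hI.exists_refines hi
    rw [Config.resolvesAddr_iff] at ha
    refine .setBuf_of_not_store hI hi ?_ rfl (by simp [Transient.result]) (by simp) (by simp)
      (by simp)
    generalize orig i = t₀ at h3 ⊢
    generalize lab i = T at h3 ⊢
    cases h3
    have hl : LoadOk C i v ⊥ a.val :=
      ⟨WithBot.bot_lt_coe _, fun k hk' hs => absurd hs (hk k hk'),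
        .inr ⟨fun j h => absurd h.symm (WithBot.coe_ne_bot), hv⟩⟩
    simpa using .loaded ha hl
  | load_execute_mem_hazard i j r args pt a v w hi hfence ha hj hk hw hne =>
    exact .rollback hI hi
  | store_execute_value i src dst v hi hfence hv => exact .storeValue hI hi hv
  | store_execute_addr_ok i src args a hi hfence ha hk => exact .storeAddr hI hi ha hk
  | store_execute_addr_hazard i k src args a r v dep b' pt hi hfence ha hk hload =>
    exact .storeHazard hI hi ha hk hload

end

/-! ### Loads across retirement, pending labels, and fetching. -/

section

variable {R V L Op : Type*}

/-- A forwarding source would be a store in front of the load, so only memory remains. This applies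
to the load of an instruction that is about to retire. -/
theorem LoadOk.mem_eq {C : Config R V L Op} {k : ℕ} {v : LVal V L} {dep : WithBot ℕ} {a : V}
    (h : LoadOk C k v dep a) (hs : ∀ j < k, ∀ src dst, C.buf.get j ≠ some (.store src dst)) :
    C.mem a = some v := by
  rcases h.source with ⟨j, dst, hd, hj, -⟩ | ⟨-, h⟩
  · have := h.dep_lt
    rw [hd] at this
    exact absurd hj (hs j (WithBot.coe_lt_coe.1 this) _ _)
  · exact h

/-- Retiring the entries below `m`, where `mem'` results from committing their stores. -/
theorem LoadOk.drop {C C' : Config R V L Op} {k m : ℕ} {v : LVal V L} {dep : WithBot ℕ} {a : V}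
    (h : LoadOk C k v dep a) (hmk : m ≤ k)
    (hbuf : ∀ j, C'.buf.get j = if m ≤ j then C.buf.get j else none)
    (hstore : ∀ j < m, ∀ src dst, C.buf.get j = some (.store src dst) →
      ∃ w a', src = .val w ∧ dst = .inr a' ∧ C'.mem a'.val = some w)
    (hmem : ∀ a, C'.mem a ≠ C.mem a → ∃ j < m, C.StoreAt j a) :
    LoadOk C' k v dep a where
  dep_lt := h.dep_lt
  le_dep := by
    rintro j hj ⟨src, b, hs, hb⟩
    rw [hbuf] at hs
    split_ifs at hs
    exact h.le_dep j hj ⟨src, b, hs, hb⟩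
  source := by
    rcases h.source with ⟨j, dst, hd, hj, hb⟩ | ⟨h1, h2⟩
    · by_cases hjm : m ≤ j
      · exact .inl ⟨j, dst, hd, by rw [hbuf, if_pos hjm, hj], hb⟩
      -- The source store is being retired. Its address is resolved by now, hence equal to `a`, and
      -- the new memory holds `v` there.
      · obtain ⟨w, a', h1, h2, h3⟩ := hstore j (by omega) _ _ hj
        cases h1
        rw [hb a' h2] at h3
        refine .inr ⟨fun j' hd' i hi => ?_, h3⟩
        have hjj : j = j' := WithBot.coe_injective (hd.symm.trans hd')
        rw [hbuf, if_neg (by omega)]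
    · refine .inr ⟨fun j hd i hi => ?_, ?_⟩
      · rw [hbuf, h1 j hd i hi, ite_self]
      · by_contra hne
        -- Memory at `a` can change only through a retired store to `a`. By `le_dep` its index is at
        -- most `dep`, yet all those indices are empty.
        obtain ⟨j, hj, hs⟩ := hmem a fun h' => hne (h'.trans h2)
        have hle := h.le_dep j (by omega) hs
        obtain ⟨src, b, hs, -⟩ := hs
        induction dep with
        | bot => exact absurd hle (not_le.2 (WithBot.bot_lt_coe j))
        | coe d =>
          have hjd : j ≤ d := WithBot.coe_le_coe.1 hle
          have := h1 d rfl j hjd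
          rw [hs] at this
          cases this

theorem pendLabels_self (lab : ℕ → Set L) (b : ℕ) : pendLabels lab b b = ∅ := by
  ext l
  simp only [pendLabels, Set.mem_empty_iff_false, iff_false]
  rintro ⟨k, h1, h2, -⟩
  omega

theorem pendLabels_succ (lab : ℕ → Set L) {b e : ℕ} (h : b < e) :
    pendLabels lab b e = lab b ∪ pendLabels lab (b + 1) e := by
  ext l
  constructor
  · rintro ⟨k, h1, h2, h3⟩
    by_cases hk : k = b
    · subst hk
      exact .inl h3
    · exact .inr ⟨k, by omega, h2, h3⟩
  · rintro (h1 | ⟨k, h1, h2, h3⟩)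
    · exact ⟨b, le_rfl, h, h1⟩
    · exact ⟨k, by omega, h2, h3⟩

section

variable [Lattice L] [OrderBot L] {M : Machine R V Op} {P : Program R V L Op}
  {C C' : Config R V L Op} {orig : ℕ → Transient R V L Op} {lab : ℕ → Set L} {b e c : ℕ} {n : V}

/-! ### Fetching -/

/-- A nonempty block ends at the fetch index. Once the buffer is empty, indices restart, so the
empty block has to be moved to the fetch index; this is sound because it contains no entry or label.
-/
theorem Inv.fresh (hI : Inv M P C orig lab b n e c) :
    ∃ b', Inv M P C orig lab b' n C.fresh c ∧ pendLabels lab b' C.fresh = pendLabels lab b e := by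
  rcases hI.chain.le.lt_or_eq with hlt | rfl
  · have h : C.fresh = e := FMap.maxIdx_add_one hlt fun k => by
      refine ⟨hI.outside k, fun ⟨h1, h2⟩ => ?_⟩
      obtain ⟨t, ht, -⟩ := hI.entry k h1 h2
      simp [ht]
    exact ⟨b, by rwa [h], by rw [h]⟩
  · obtain ⟨rfl, rfl⟩ := hI.chain.count_eq_zero
    refine ⟨C.fresh, ⟨.nil _ _, fun k h1 h2 => by omega, fun k hk => ?_⟩, ?_⟩
    · have := hI.outside k hk
      omega
    · rw [pendLabels_self, pendLabels_self]

theorem Fetched.refines_self {i len : ℕ} {m : V} (h : Fetched M P orig i n len m) {k : ℕ}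
    (hk : i ≤ k) (hk' : k < i + len) : Refines M C k (orig k) (orig k) ∅ ∧
      ∀ r args v j pt, orig k ≠ .loadGuess r args v j pt := by
  cases h with
  | call hP ho h1 h2 =>
    obtain rfl | rfl | rfl : k = i ∨ k = i + 1 ∨ k = i + 2 := by omega
    · rw [ho]; exact ⟨.call, by simp⟩
    · rw [h1]; exact ⟨.op _ _ _, by simp⟩
    · rw [h2]; exact ⟨.store (.inl rfl), by simp⟩
  | ret g hP ho h1 h2 h3 =>
    obtain rfl | rfl | rfl | rfl : k = i ∨ k = i + 1 ∨ k = i + 2 ∨ k = i + 3 := by omega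
    · rw [ho]; exact ⟨.ret, by simp⟩
    · rw [h1]; exact ⟨.load _ _ _, by simp⟩
    · rw [h2]; exact ⟨.op _ _ _, by simp⟩
    · rw [h3]; exact ⟨.jmpi _ _, by simp⟩
  | _ =>
    obtain rfl : k = i := by omega
    rename_i ho
    rw [ho]
    refine ⟨?_, by simp⟩
    constructor
    try exact .inl rfl

/-- What fetching an instruction preserves. -/
def FetchPost (M : Machine R V Op) (P : Program R V L Op) (C C' : Config R V L Op)
    (lab : ℕ → Set L) (b : ℕ) (n : V) (e c : ℕ) : Prop :=
  ∃ orig' lab' b' e', Inv M P C' orig' lab' b' n e' (c + 1) ∧ C'.reg = C.reg ∧ C'.mem = C.mem ∧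
    pendLabels lab' b' e' = pendLabels lab b e ∧ (C.NoGuess → C'.NoGuess)

/-- Stages refer only to smaller indices, so appended entries do not disturb the old ones. A new
entry is the initial stage of itself and exposes no label. -/
theorem FetchPost.of_fetched (hI : Inv M P C orig lab b n e c) {new : ℕ → Transient R V L Op}
    {len : ℕ} (hF : Fetched M P new C.fresh C.pc len C'.pc)
    (hbuf : ∀ k, C'.buf.get k =
      if C.fresh ≤ k ∧ k < C.fresh + len then some (new k) else C.buf.get k)
    (hreg : C'.reg = C.reg) (hmem : C'.mem = C.mem) : FetchPost M P C C' lab b n e c := by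
  obtain ⟨b', hI', hl⟩ := hI.fresh
  have hle := hI'.chain.le
  refine ⟨fun k => if k < C.fresh then orig k else new k,
    fun k => if k < C.fresh then lab k else ∅, b', C.fresh + len, ⟨?_, ?_, ?_⟩, hreg, hmem, ?_, ?_⟩
  · refine (hI'.chain.congr fun k _ hk => if_pos hk).snoc (hF.congr fun k hk _ => if_neg ?_)
    omega
  · intro k hbk hk
    by_cases hkf : k < C.fresh
    · obtain ⟨t, h1, h2⟩ := hI'.entry k hbk hkf
      refine ⟨t, by rw [hbuf, if_neg (by omega), h1], ?_⟩
      simp only [hkf, if_true]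
      exact h2.congr hreg hmem fun j hj => by rw [hbuf, if_neg (by omega)]
    · refine ⟨new k, by rw [hbuf, if_pos ⟨by omega, hk⟩], ?_⟩
      simp only [hkf, if_false]
      exact (hF.refines_self (by omega) hk).1
  · intro k hk
    rw [hbuf] at hk
    split_ifs at hk with h
    · omega
    · have := hI'.outside k hk
      omega
  · rw [← hl]
    ext l
    constructor
    · rintro ⟨k, h1, h2, h3⟩
      by_cases hk : k < C.fresh
      · simp only [hk, if_true] at h3
        exact ⟨k, h1, hk, h3⟩
      · simp only [hk, if_false] at h3
        exact h3.elim
    · rintro ⟨k, h1, h2, h3⟩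
      exact ⟨k, h1, by omega, by simpa only [h2, if_true] using h3⟩
  · intro hng k r args v j pt hk
    rw [hbuf] at hk
    split_ifs at hk with h
    · exact (hF.refines_self (C := C) h.1 h.2).2 _ _ _ _ _ (Option.some.inj hk)
    · exact hng _ _ _ _ _ _ hk

theorem FetchPost.single (hI : Inv M P C orig lab b n e c) {t : Transient R V L Op} {m : V}
    (hF : Fetched M P (fun _ => t) C.fresh C.pc 1 m) :
    FetchPost M P C { C.setBuf C.fresh t with pc := m } lab b n e c := by
  refine .of_fetched hI (new := fun _ => t) hF (fun k => ?_) rfl rfl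
  change (C.buf.set C.fresh t).get k = _
  rw [FMap.get_set]
  congr 1
  simp only [eq_iff_iff]
  omega

theorem FetchPost.ret (hI : Inv M P C orig lab b n e c) (m : V) (hP : P C.pc = some .ret) :
    FetchPost M P C (C.fetchRet M m) lab b n e c := by
  refine .of_fetched hI (len := 4)
    (new := fun k => ((C.fetchRet M m).buf.get k).getD .fence)
    (.ret m hP ?_ ?_ ?_ ?_) (fun k => ?_) rfl rfl
  · simp [Config.fetchRet, FMap.get_set]
  · simp [Config.fetchRet, FMap.get_set]
  · simp [Config.fetchRet, FMap.get_set]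
  · simp [Config.fetchRet]
  · by_cases h : C.fresh ≤ k ∧ k < C.fresh + 4
    · obtain h | h | h | h : k = C.fresh ∨ k = C.fresh + 1 ∨ k = C.fresh + 2 ∨ k = C.fresh + 3 := by
        omega
      all_goals simp [Config.fetchRet, FMap.get_set, h]
    · rw [if_neg h]
      simp only [Config.fetchRet, FMap.get_set]
      rw [if_neg (by omega), if_neg (by omega), if_neg (by omega), if_neg (by omega)]

theorem Step.fetchPost [DecidableEq R] [DecidableEq V] {d : Directive V} {O : List (Obs V L)}
    (h : Step M P C d O C') (hd : d.isFetch = true) (hI : Inv M P C orig lab b n e c) :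
    FetchPost M P C C' lab b n e c ∧ O = [] ∧ d.isRetire = false := by
  cases h with
  | op_fetch o r args next hP => exact ⟨.single hI (.op hP rfl), rfl, rfl⟩
  | load_fetch r args next hP => exact ⟨.single hI (.load hP rfl), rfl, rfl⟩
  | store_fetch src args next hP => exact ⟨.single hI (.store hP rfl), rfl, rfl⟩
  | fence_fetch next hP => exact ⟨.single hI (.fence hP rfl), rfl, rfl⟩
  | br_fetch g o args nT nF hP => exact ⟨.single hI (.br _ hP rfl), rfl, rfl⟩
  | jmpi_fetch m args hP => exact ⟨.single hI (.jmpi _ hP rfl), rfl, rfl⟩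
  | ret_fetch_rsb m hP htop => exact ⟨.ret hI m hP, rfl, rfl⟩
  | ret_fetch_rsb_empty m hP htop => exact ⟨.ret hI m hP, rfl, rfl⟩
  | call_fetch nf nret hP =>
    refine ⟨.of_fetched hI (len := 3)
      (new := fun k => if k = C.fresh then .call
        else if k = C.fresh + 1 then .op M.rsp M.succ [.reg M.rsp]
        else .store (.val ⟨nret, ⊥⟩) (.inl [.reg M.rsp]))
      (.call hP ?_ ?_ ?_) (fun k => ?_) rfl rfl, rfl, rfl⟩
    · simp
    · simp
    · simp
    · by_cases h : C.fresh ≤ k ∧ k < C.fresh + 3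
      · obtain h | h | h : k = C.fresh ∨ k = C.fresh + 1 ∨ k = C.fresh + 2 := by
          omega
        all_goals simp [FMap.get_set, h]
      · rw [if_neg h]
        simp only [FMap.get_set]
        rw [if_neg (by omega), if_neg (by omega), if_neg (by omega)]
  | _ => cases hd

end

end

section

variable {R V L Op : Type*} [Lattice L] [OrderBot L] {M : Machine R V Op}
  {P : Program R V L Op} {C C' : Config R V L Op} {orig : ℕ → Transient R V L Op}
  {lab : ℕ → Set L} {b e c : ℕ} {n : V}

/-! ### Retiring -/

theorem Inv.get_eq_none (hI : Inv M P C orig lab b n e c) {j : ℕ} (hj : j < b) :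
    C.buf.get j = none := by
  by_contra h
  exact absurd (hI.outside j h).1 (by omega)

theorem Inv.resolveReg_eq_reg (hI : Inv M P C orig lab b n e c) : C.resolveReg b = C.reg :=
  Config.resolveReg_eq_reg fun _ hj => hI.get_eq_none hj

theorem Inv.eq_of_retirable (hI : Inv M P C orig lab b n e c) {i : ℕ} {t : Transient R V L Op}
    (hmin : C.Retirable i) (hi : C.buf.get i = some t) : i = b := by
  obtain ⟨h1, h2, -⟩ := hI.exists_refines hi
  obtain ⟨t', h3, -⟩ := hI.entry b le_rfl (by omega)
  exact hmin.symm.trans (FMap.minIdx_eq (by simp [h3]) fun k hk => (hI.outside k hk).1)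

/-- Removing the entries of the oldest instruction. -/
theorem Inv.drop (hP : P.NotRead M.rret) (hI : Inv M P C orig lab b n e c) {m c' : ℕ} {q : V}
    (hbm : b ≤ m) (hchain : Chain M P orig m q e C.pc c') (hpc : C'.pc = C.pc)
    (hbuf : ∀ j, C'.buf.get j = if m ≤ j then C.buf.get j else none)
    (hreg : ∀ r ≠ M.rret, C'.reg r = C.resolveReg m r)
    (hstore : ∀ j < m, ∀ src dst, C.buf.get j = some (.store src dst) →
      ∃ w a', src = .val w ∧ dst = .inr a' ∧ C'.mem a'.val = some w)
    (hmem : ∀ a, C'.mem a ≠ C.mem a → ∃ j < m, C.StoreAt j a) :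
    Inv M P C' orig lab m q e c' where
  chain := by rwa [hpc]
  outside := fun k hk => by
    rw [hbuf] at hk
    split_ifs at hk with h
    · exact ⟨h, (hI.outside k hk).2⟩
    · exact absurd rfl hk
  entry := fun k hmk hke => by
    obtain ⟨t, h1, h2⟩ := hI.entry k (by omega) hke
    refine ⟨t, by rw [hbuf, if_pos hmk, h1], h2.mono ?_ ?_ ?_⟩
    · intro r hr v hv
      refine Config.resolveReg_mono hmk ?_ ?_ ?_ hv
      · intro hn w hw
        rw [Config.resolveReg_eq_reg fun j hj => by rw [hbuf, if_neg (by omega)], hreg r, hw]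
        -- The committed registers may be wrong at the temporary register. An entry that reads it is
        -- preceded, within the surviving buffer, by the load of its own return, so the base value
        -- is never consulted.
        rintro rfl
        obtain ⟨j, pt, hj1, hj2, hj3⟩ := hchain.exists_load_rret hP hmk hke hr
        obtain ⟨t', h3, h4⟩ := hI.entry j (by omega) (by omega)
        refine hn j hj1 hj2 ⟨t', h3, ?_⟩
        rw [h4.target_eq, hj3]
        rfl
      · intro j hj _
        simp only [Config.Assigns, hbuf, if_pos hj]
      · intro j hj _ w hw
        rwa [hbuf, if_pos hj]
    · intro r v dep a pt _ hl
      exact hl.drop hmk hbuf hstore hmem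
    · intro j _ v hs u hu
      rw [hbuf] at hu
      split_ifs at hu
      exact hs u hu

/-- What retiring an instruction preserves. -/
def RetirePost [DecidableEq R] [DecidableEq V] (M : Machine R V Op) (P : Program R V L Op)
    (C C' : Config R V L Op) (O : List (Obs V L)) (orig : ℕ → Transient R V L Op)
    (lab : ℕ → Set L) (b : ℕ) (n : V) (e c : ℕ) : Prop :=
  ∃ b' n' c' T, c = c' + 1 ∧ Inv M P C' orig lab b' n' e c' ∧
    ArchStep M P ⟨C.reg, C.mem, n⟩ T ⟨C'.reg, C'.mem, n'⟩ ∧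
    -- Equality is needed: one inclusion serves arbitrary executions, the other sequential ones. The
    -- observations of the retirement itself add nothing, since a written address was exposed when
    -- it was resolved.
    pendLabels lab b e = T ∪ pendLabels lab b' e ∧ obsLabels O ⊆ T ∧ (C.NoGuess → C'.NoGuess)

theorem RetirePost.of_drop [DecidableEq R] [DecidableEq V] (hP : P.NotRead M.rret)
    (hI : Inv M P C orig lab b n e c) {O : List (Obs V L)} {m c' : ℕ} {q : V} {T : Set L}
    (hbm : b ≤ m) (hchain : Chain M P orig m q e C.pc c') (hc : c = c' + 1) (hpc : C'.pc = C.pc)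
    (hbuf : ∀ j, C'.buf.get j = if m ≤ j then C.buf.get j else none)
    (hreg : ∀ r ≠ M.rret, C'.reg r = C.resolveReg m r)
    (hstore : ∀ j < m, ∀ src dst, C.buf.get j = some (.store src dst) →
      ∃ w a', src = .val w ∧ dst = .inr a' ∧ C'.mem a'.val = some w)
    (hmem : ∀ a, C'.mem a ≠ C.mem a → ∃ j < m, C.StoreAt j a)
    (hstep : ArchStep M P ⟨C.reg, C.mem, n⟩ T ⟨C'.reg, C'.mem, q⟩)
    (hlab : pendLabels lab b e = T ∪ pendLabels lab m e) (hO : obsLabels O ⊆ T) :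
    RetirePost M P C C' O orig lab b n e c := by
  refine ⟨m, q, c', T, hc, hI.drop hP hbm hchain hpc hbuf hreg hstore hmem, hstep, hlab, hO, ?_⟩
  intro hng k r args v j pt hk
  rw [hbuf] at hk
  split_ifs at hk
  exact hng _ _ _ _ _ _ hk

/-- Removing the oldest entry when it is not a store. -/
theorem RetirePost.single [DecidableEq R] [DecidableEq V] (hP : P.NotRead M.rret)
    (hI : Inv M P C orig lab b n e c) {t : Transient R V L Op} {c' : ℕ} {q : V}
    (hi : C.buf.get b = some t) (hchain : Chain M P orig (b + 1) q e C.pc c') (hc : c = c' + 1)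
    (hpc : C'.pc = C.pc) (hbuf : C'.buf = C.buf.erase b)
    (hreg : C'.reg = C.resolveReg (b + 1)) (hmem : C'.mem = C.mem)
    (ht : ∀ src dst, t ≠ .store src dst)
    (hstep : ArchStep M P ⟨C.reg, C.mem, n⟩ (lab b) ⟨C'.reg, C'.mem, q⟩) :
    RetirePost M P C C' [] orig lab b n e c := by
  obtain ⟨-, hbe, -⟩ := hI.exists_refines hi
  refine .of_drop hP hI (Nat.le_succ b) hchain hc hpc ?_ (fun r _ => by rw [hreg]) ?_ ?_ hstep
    (pendLabels_succ lab hbe) (by simp)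
  · intro j
    rw [hbuf, FMap.get_erase]
    rcases lt_trichotomy j b with h | rfl | h
    · rw [if_pos (by omega), if_neg (by omega), hI.get_eq_none h]
    · simp
    · rw [if_pos (by omega), if_pos (by omega)]
  · intro j hj src dst h
    rcases Nat.lt_succ_iff_lt_or_eq.1 hj with h' | rfl
    · rw [hI.get_eq_none h'] at h
      cases h
    · exact absurd (Option.some.inj (hi.symm.trans h)) (ht _ _)
  · intro a h
    exact absurd (congrFun hmem a) h

theorem Inv.exists_fetched (hI : Inv M P C orig lab b n e c) {t : Transient R V L Op}
    (hi : C.buf.get b = some t) : ∃ len q c', Fetched M P orig b n len q ∧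
      Chain M P orig (b + len) q e C.pc c' ∧ c = c' + 1 := by
  obtain ⟨-, hbe, -⟩ := hI.exists_refines hi
  have hc := hI.chain
  generalize C.pc = m at hc
  cases hc with
  | nil => omega
  | cons h h' => exact ⟨_, _, _, h, h', rfl⟩

/-- The oldest entry sees the committed registers and has no store in front of it, so its stage
speaks about the architectural state. Calls and returns begin with a marker, so such an entry is a
whole instruction. -/
theorem RetirePost.value [DecidableEq R] [DecidableEq V] (hP : P.NotRead M.rret)
    (hI : Inv M P C orig lab b n e c) {t : Transient R V L Op} {r : R} {v : LVal V L}
    (hi : C.buf.get b = some t) (ht : t.IsValue r v) :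
    RetirePost M P C { C with reg := Function.update C.reg r (some v), buf := C.buf.erase b } []
      orig lab b n e c := by
  obtain ⟨-, -, h3⟩ := hI.exists_refines hi
  obtain ⟨len, q, c', hF, hc, rfl⟩ := hI.exists_fetched hi
  have htar : t.target = some r := by cases ht <;> rfl
  have hres : t.result = some v := by cases ht <;> rfl
  have hst : ∀ src dst, t ≠ .store src dst := by
    rintro src dst rfl
    cases ht
  have hreg : Function.update C.reg r (some v) = C.resolveReg (b + 1) := by
    rw [Config.resolveReg_succ_target hi htar, hI.resolveReg_eq_reg, hres]
  have hb := hI.resolveReg_eq_reg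
  suffices h : len = 1 ∧
      ArchStep M P ⟨C.reg, C.mem, n⟩ (lab b) ⟨Function.update C.reg r (some v), C.mem, q⟩ by
    obtain ⟨rfl, h⟩ := h
    exact .single hP hI hi hc rfl rfl rfl hreg rfl hst h
  generalize hob : orig b = t₀ at h3
  generalize hT : lab b = T at h3
  cases ht with
  | value r v =>
    cases h3 with
    | value hvs hv =>
      rw [hb] at hvs
      cases hF with
      | op hP ho =>
        cases ho.symm.trans hob
        exact ⟨rfl, .op hP hvs hv⟩
      | _ => simp_all
  | loaded r v dep a pt =>
    cases h3 with
    | loaded ha hl =>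
      rw [hb] at ha
      have hm := hl.mem_eq fun j hj src dst => by rw [hI.get_eq_none hj]; simp
      cases hF with
      | load hP ho =>
        cases ho.symm.trans hob
        exact ⟨rfl, .load hP ha hm⟩
      | _ => simp_all

theorem RetirePost.jump [DecidableEq R] [DecidableEq V] (hP : P.NotRead M.rret)
    (hI : Inv M P C orig lab b n e c) {m : V} (hi : C.buf.get b = some (.jump m)) :
    RetirePost M P C { C with buf := C.buf.erase b } [] orig lab b n e c := by
  obtain ⟨-, -, h3⟩ := hI.exists_refines hi
  obtain ⟨len, q, c', hF, hc, rfl⟩ := hI.exists_fetched hi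
  have hb := hI.resolveReg_eq_reg
  suffices h : len = 1 ∧ ArchStep M P ⟨C.reg, C.mem, n⟩ (lab b) ⟨C.reg, C.mem, q⟩ by
    obtain ⟨rfl, h⟩ := h
    refine .single hP hI hi hc rfl rfl rfl ?_ rfl (by simp) h
    rw [Config.resolveReg_succ_no_target hi rfl, hb]
  generalize hob : orig b = t₀ at h3
  generalize hT : lab b = T at h3
  cases h3 with
  | brJump hvs hcd hg =>
    rw [hb] at hvs
    cases hF with
    | br g hP ho =>
      cases ho.symm.trans hob
      subst hg
      exact ⟨rfl, .br hP hvs hcd⟩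
    | _ => simp_all
  | jmpiJump hn hg =>
    rw [hb] at hn
    cases hF with
    | jmpi g hP ho =>
      cases ho.symm.trans hob
      subst hg
      exact ⟨rfl, .jmpi hP hn⟩
    | _ => simp_all

theorem RetirePost.fence [DecidableEq R] [DecidableEq V] (hP : P.NotRead M.rret)
    (hI : Inv M P C orig lab b n e c) (hi : C.buf.get b = some .fence) :
    RetirePost M P C { C with buf := C.buf.erase b } [] orig lab b n e c := by
  obtain ⟨-, -, h3⟩ := hI.exists_refines hi
  obtain ⟨len, q, c', hF, hc, rfl⟩ := hI.exists_fetched hi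
  suffices h : len = 1 ∧ ArchStep M P ⟨C.reg, C.mem, n⟩ (lab b) ⟨C.reg, C.mem, q⟩ by
    obtain ⟨rfl, h⟩ := h
    refine .single hP hI hi hc rfl rfl rfl ?_ rfl (by simp) h
    rw [Config.resolveReg_succ_no_target hi rfl, hI.resolveReg_eq_reg]
  generalize hob : orig b = t₀ at h3
  generalize hT : lab b = T at h3
  cases h3 with
  | fence =>
    cases hF with
    | fence hP ho => exact ⟨rfl, .fence hP⟩
    | _ => simp_all

theorem RetirePost.store [DecidableEq R] [DecidableEq V] (hP : P.NotRead M.rret)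
    (hI : Inv M P C orig lab b n e c) {v a : LVal V L}
    (hi : C.buf.get b = some (.store (.val v) (.inr a))) :
    RetirePost M P C
      { C with mem := Function.update C.mem a.val (some v), buf := C.buf.erase b } [.write a]
      orig lab b n e c := by
  obtain ⟨-, hbe, h3⟩ := hI.exists_refines hi
  obtain ⟨len, q, c', hF, hc, rfl⟩ := hI.exists_fetched hi
  have hb := hI.resolveReg_eq_reg
  obtain ⟨rfl, hT, hstep⟩ : len = 1 ∧ lab b = {a.lab} ∧
      ArchStep M P ⟨C.reg, C.mem, n⟩ {a.lab}
        ⟨C.reg, Function.update C.mem a.val (some v), q⟩ := by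
    generalize hob : orig b = t₀ at h3
    generalize hT : lab b = T at h3
    cases h3 with
    | storeAddr hs ha =>
      rw [hb] at hs ha
      cases hF with
      | store hP ho =>
        cases ho.symm.trans hob
        exact ⟨rfl, rfl, .store hP ha hs.eval_of_val⟩
      | _ => simp_all
  refine .of_drop hP hI (Nat.le_succ b) hc rfl rfl ?_ (fun r _ => ?_) ?_ ?_ hstep
    (by rw [pendLabels_succ lab hbe, hT]) (by simp)
  · intro j
    change (C.buf.erase b).get j = _
    rw [FMap.get_erase]
    rcases lt_trichotomy j b with h | rfl | h
    · rw [if_pos (by omega), if_neg (by omega), hI.get_eq_none h]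
    · simp
    · rw [if_pos (by omega), if_pos (by omega)]
  · rw [Config.resolveReg_succ_no_target hi rfl, hb]
  · intro j hj src dst h
    rcases Nat.lt_succ_iff_lt_or_eq.1 hj with h' | rfl
    · rw [hI.get_eq_none h'] at h
      cases h
    · cases hi.symm.trans h
      exact ⟨v, a, rfl, rfl, Function.update_self _ _ _⟩
  · intro a' h
    refine ⟨b, Nat.lt_succ_self b, _, _, hi, ?_⟩
    by_contra hne
    exact h (Function.update_of_ne (Ne.symm hne) _ _)

/-- Resolving registers through the three entries replays the in-order effect: the store address is
computed from the updated stack pointer. -/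
theorem RetirePost.call [DecidableEq R] [DecidableEq V] (hP : P.NotRead M.rret)
    (hI : Inv M P C orig lab b n e c) {vsp v a : LVal V L} (hi : C.buf.get b = some .call)
    (hi1 : C.buf.get (b + 1) = some (.value M.rsp vsp))
    (hi2 : C.buf.get (b + 2) = some (.store (.val v) (.inr a))) :
    RetirePost M P C
      { C with
        reg := Function.update C.reg M.rsp (some vsp)
        mem := Function.update C.mem a.val (some v)
        buf := C.buf.above (b + 2) } [.write a] orig lab b n e c := by
  obtain ⟨-, hbe, h3⟩ := hI.exists_refines hi
  obtain ⟨-, hbe1, h31⟩ := hI.exists_refines hi1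
  obtain ⟨-, hbe2, h32⟩ := hI.exists_refines hi2
  obtain ⟨len, q, c', hF, hc, rfl⟩ := hI.exists_fetched hi
  have hb := hI.resolveReg_eq_reg
  have hb1 : C.resolveReg (b + 1) = C.reg := by
    rw [Config.resolveReg_succ_no_target hi rfl, hb]
  have hb2 : C.resolveReg (b + 2) = Function.update C.reg M.rsp (some vsp) := by
    rw [Config.resolveReg_succ_target hi1 rfl, hb1]
    rfl
  have hb3 : C.resolveReg (b + 3) = Function.update C.reg M.rsp (some vsp) := by
    rw [Config.resolveReg_succ_no_target hi2 rfl, hb2]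
  obtain ⟨rfl, hT, hT1, hT2, hstep⟩ : len = 3 ∧ lab b = ∅ ∧ lab (b + 1) = ∅ ∧
      lab (b + 2) = {a.lab} ∧ ArchStep M P ⟨C.reg, C.mem, n⟩ {a.lab}
        ⟨Function.update C.reg M.rsp (some vsp), Function.update C.mem a.val (some v), q⟩ := by
    generalize hob : orig b = t₀ at h3
    generalize hob1 : orig (b + 1) = t₁ at h31
    generalize hob2 : orig (b + 2) = t₂ at h32
    generalize hT : lab b = T at h3
    generalize hT1 : lab (b + 1) = T₁ at h31
    generalize hT2 : lab (b + 2) = T₂ at h32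
    cases h3
    cases h31 with
    | value hvs hv =>
    cases h32 with
    | storeAddr hs ha =>
    rw [hb1] at hvs
    rw [hb2] at hs ha
    cases hF with
    | call hP ho h1 h2 =>
      cases h1.symm.trans hob1
      cases h2.symm.trans hob2
      have := hs.eval_of_val
      cases this
      exact ⟨rfl, rfl, rfl, rfl, .call hP hvs hv ha⟩
    | _ => simp_all
  refine .of_drop hP hI (by omega) hc rfl rfl ?_ (fun r _ => ?_) ?_ ?_ hstep
    (by
      rw [pendLabels_succ lab hbe, pendLabels_succ lab hbe1, pendLabels_succ lab hbe2, hT, hT1,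
        hT2, Set.empty_union, Set.empty_union]) (by simp)
  · intro j
    change (C.buf.above (b + 2)).get j = _
    rw [FMap.get_above]
    rfl
  · rw [hb3]
  · intro j hj src dst h
    obtain h' | rfl | rfl | rfl : j < b ∨ j = b ∨ j = b + 1 ∨ j = b + 2 := by omega
    · rw [hI.get_eq_none h'] at h
      cases h
    · cases hi.symm.trans h
    · cases hi1.symm.trans h
    · cases hi2.symm.trans h
      exact ⟨v, a, rfl, rfl, Function.update_self _ _ _⟩
  · intro a' h
    refine ⟨b + 2, by omega, _, _, hi2, ?_⟩
    by_contra hne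
    exact h (Function.update_of_ne (Ne.symm hne) _ _)

/-- The stack pointer update ignores the load and the jump ignores the stack pointer update, because
the two registers are distinct. The load reads memory, as there is no store up to it. Committed and
resolved registers then agree away from the temporary register. -/
theorem RetirePost.ret [DecidableEq R] [DecidableEq V] (hP : P.NotRead M.rret)
    (hI : Inv M P C orig lab b n e c) {t1 t2 : Transient R V L Op} {v1 v2 : LVal V L} {m : V}
    (hi : C.buf.get b = some .ret)
    (hi1 : C.buf.get (b + 1) = some t1) (ht1 : t1.IsValue M.rret v1)
    (hi2 : C.buf.get (b + 2) = some t2) (ht2 : t2.IsValue M.rsp v2)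
    (hi3 : C.buf.get (b + 3) = some (.jump m)) :
    RetirePost M P C
      { C with
        reg := Function.update C.reg M.rsp (some v2)
        buf := C.buf.above (b + 3) } [] orig lab b n e c := by
  obtain ⟨-, hbe, h3⟩ := hI.exists_refines hi
  obtain ⟨-, hbe1, h31⟩ := hI.exists_refines hi1
  obtain ⟨-, hbe2, h32⟩ := hI.exists_refines hi2
  obtain ⟨-, hbe3, h33⟩ := hI.exists_refines hi3
  obtain ⟨len, q, c', hF, hc, rfl⟩ := hI.exists_fetched hi
  have htar1 : t1.target = some M.rret := by cases ht1 <;> rfl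
  have hres1 : t1.result = some v1 := by cases ht1 <;> rfl
  have htar2 : t2.target = some M.rsp := by cases ht2 <;> rfl
  have hres2 : t2.result = some v2 := by cases ht2 <;> rfl
  have hb := hI.resolveReg_eq_reg
  have hb1 : C.resolveReg (b + 1) = C.reg := by
    rw [Config.resolveReg_succ_no_target hi rfl, hb]
  have hb2 : C.resolveReg (b + 2) = Function.update C.reg M.rret (some v1) := by
    rw [Config.resolveReg_succ_target hi1 htar1, hb1, hres1]
  have hb3 : C.resolveReg (b + 3) =
      Function.update (Function.update C.reg M.rret (some v1)) M.rsp (some v2) := by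
    rw [Config.resolveReg_succ_target hi2 htar2, hb2, hres2]
  have hb4 : C.resolveReg (b + 4) =
      Function.update (Function.update C.reg M.rret (some v1)) M.rsp (some v2) := by
    rw [Config.resolveReg_succ_no_target hi3 rfl, hb3]
  have hne := M.rret_ne_rsp
  have hst : ∀ j < b + 4, ∀ src dst, C.buf.get j ≠ some (.store src dst) := by
    intro j hj src dst h
    obtain h' | rfl | rfl | rfl | rfl :
      j < b ∨ j = b ∨ j = b + 1 ∨ j = b + 2 ∨ j = b + 3 := by omega
    · rw [hI.get_eq_none h'] at h
      cases h
    · cases hi.symm.trans h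
    · cases hi1.symm.trans h
      cases ht1
    · cases hi2.symm.trans h
      cases ht2
    · cases hi3.symm.trans h
  obtain ⟨rfl, hT, hstep⟩ : len = 4 ∧ lab b = ∅ ∧
      ArchStep M P ⟨C.reg, C.mem, n⟩ (lab (b + 1) ∪ (lab (b + 2) ∪ lab (b + 3)))
        ⟨Function.update C.reg M.rsp (some v2), C.mem, q⟩ := by
    generalize hob : orig b = t₀ at h3
    generalize hT : lab b = T at h3
    cases h3
    cases hF with
    | ret g hP ho h1 h2 h4 =>
      rw [h1] at h31
      rw [h2] at h32
      rw [h4] at h33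
      generalize lab (b + 1) = T₁ at h31
      generalize lab (b + 2) = T₂ at h32
      generalize lab (b + 3) = T₃ at h33
      cases ht1 with
      | value => cases h31
      | loaded r v dep a pt =>
      cases h31 with
      | loaded ha hl =>
      cases ht2 with
      | loaded => cases h32
      | value =>
      cases h32 with
      | value hvs hv =>
      cases h33 with
      | jmpiJump hn hg =>
      subst hg
      rw [hb1] at ha
      rw [hb3] at hn
      replace hvs := EvalArgs.mono hvs (g := C.reg) fun r hr v hv => by
        rw [hb2] at hv
        obtain rfl : r = M.rsp := by simpa using hr
        rwa [Function.update_of_ne hne.symm] at hv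
      replace hn := EvalAddr.mono hn (g := Function.update C.reg M.rret (some v1))
        fun r hr v hv => by
          obtain rfl : r = M.rret := by simpa using hr
          rwa [Function.update_of_ne hne] at hv
      have hm := hl.mem_eq fun j hj => hst j (by omega)
      refine ⟨rfl, rfl, ?_⟩
      rw [Set.empty_union, Set.singleton_union]
      exact .ret hP ha hm hvs hv hn
    | _ => simp_all
  refine .of_drop hP hI (by omega) hc rfl rfl ?_ (fun r hr => ?_) ?_ ?_ hstep
    (by
      rw [pendLabels_succ lab hbe, pendLabels_succ lab hbe1, pendLabels_succ lab hbe2,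
        pendLabels_succ lab hbe3, hT, Set.empty_union]
      simp only [Set.union_assoc]) (by simp)
  · intro j
    change (C.buf.above (b + 3)).get j = _
    rw [FMap.get_above]
    rfl
  · change Function.update C.reg M.rsp (some v2) r = _
    rw [hb4]
    simp only [Function.update_apply, if_neg hr]
  · intro j hj src dst h
    exact absurd h (hst j hj src dst)
  · intro a h
    exact absurd rfl h

theorem Step.retirePost [DecidableEq R] [DecidableEq V] {d : Directive V} {O : List (Obs V L)}
    (hP : P.NotRead M.rret) (h : Step M P C d O C') (hd : d.isRetire = true)
    (hI : Inv M P C orig lab b n e c) : RetirePost M P C C' O orig lab b n e c := by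
  cases h with
  | value_retire i t r v hmin hi ht =>
    obtain rfl := hI.eq_of_retirable hmin hi
    exact .value hP hI hi ht
  | jump_retire i n hmin hi =>
    obtain rfl := hI.eq_of_retirable hmin hi
    exact .jump hP hI hi
  | fence_retire i hmin hi =>
    obtain rfl := hI.eq_of_retirable hmin hi
    exact .fence hP hI hi
  | store_retire i v a hmin hi =>
    obtain rfl := hI.eq_of_retirable hmin hi
    exact .store hP hI hi
  | call_retire i vsp v a hmin hi hi1 hi2 =>
    obtain rfl := hI.eq_of_retirable hmin hi
    exact .call hP hI hi hi1 hi2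
  | ret_retire i t1 t2 v1 v2 m hmin hi hi1 ht1 hi2 ht2 hi3 =>
    obtain rfl := hI.eq_of_retirable hmin hi
    exact .ret hP hI hi hi1 ht1 hi2 ht2 hi3
  | _ => cases hd

end

section

variable {R V L Op : Type*}

/-! ### Executions -/

/-- The architectural part of a configuration. -/
def Config.state (C : Config R V L Op) : ArchState R V L := ⟨C.reg, C.mem, C.pc⟩

theorem Config.Idle.noGuess {C : Config R V L Op} (h : C.Idle) : C.NoGuess := by
  intro k r args v j pt hk
  rw [h] at hk
  cases hk

theorem pendLabels_empty (b e : ℕ) : pendLabels (fun _ => (∅ : Set L)) b e = ∅ := by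
  ext l
  simp [pendLabels]

section

variable [Lattice L] [OrderBot L] {M : Machine R V Op}
  {P : Program R V L Op} {C C' : Config R V L Op} {orig : ℕ → Transient R V L Op}
  {lab : ℕ → Set L} {b e c : ℕ} {n : V}

theorem Inv.of_idle (h : C.Idle) :
    Inv M P C (fun _ => .fence) (fun _ => ∅) 1 C.pc 1 0 where
  chain := .nil _ _
  entry := fun k h1 h2 => by omega
  outside := fun k hk => by
    rw [h] at hk
    exact absurd rfl hk

theorem Inv.idle (hI : Inv M P C orig lab b n e 0) : C.Idle := by
  obtain ⟨rfl, -⟩ := hI.chain.eq_of_zero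
  refine FMap.ext_get fun k => ?_
  by_contra h
  have := hI.outside k h
  omega

theorem Inv.of_idle_eq (hI : Inv M P C orig lab b n e c) (h : C.Idle) :
    c = 0 ∧ n = C.pc ∧ pendLabels lab b e = ∅ := by
  rcases hI.chain.le.lt_or_eq with hlt | rfl
  · obtain ⟨t, ht, -⟩ := hI.entry b le_rfl hlt
    rw [h] at ht
    cases ht
  · obtain ⟨h1, h2⟩ := hI.chain.count_eq_zero
    exact ⟨h1, h2, pendLabels_self lab b⟩

variable [DecidableEq R] [DecidableEq V]

/-- Every execution follows an architectural run, and exposes its labels. -/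
theorem Exec.archRun_of_inv (hP : P.NotRead M.rret) {D : List (Directive V)}
    {O : List (Obs V L)} (h : Exec M P C D O C') (hI : Inv M P C orig lab b n e c) :
    ∃ orig' lab' b' n' e' c' A, Inv M P C' orig' lab' b' n' e' c' ∧
      ArchRun M P ⟨C.reg, C.mem, n⟩ (numRetired D) A ⟨C'.reg, C'.mem, n'⟩ ∧
      A ∪ pendLabels lab' b' e' ⊆ pendLabels lab b e ∪ obsLabels O ∧
      c' + numRetired D ≤ c + D.countP Directive.isFetch := by
  induction h generalizing orig lab b n e c with
  | nil C =>
    exact ⟨orig, lab, b, n, e, c, ∅, hI, .nil _, by simp, by simp [numRetired]⟩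
  | @cons C C₁ C₂ d D O O' hs _ ih =>
    rcases hf : d.isFetch with _ | _
    · rcases hr : d.isRetire with _ | _
      · obtain ⟨orig₁, lab₁, e₁, c₁, h1, h2, h3, h4, h5, -⟩ := hs.execPost hf hr hI
        obtain ⟨orig', lab', b', n', e', c', A, h6, h7, h8, h9⟩ := ih h1
        refine ⟨orig', lab', b', n', e', c', A, h6, ?_, h8.trans ?_, ?_⟩
        · rw [h2, h3] at h7
          simpa [numRetired, hr] using h7
        · rw [obsLabels_append, ← Set.union_assoc]
          exact Set.union_subset_union_left _ h5
        · simp only [numRetired, List.countP_cons, hf, hr] at h9 ⊢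
          simp only [Bool.false_eq_true, if_false]
          omega
      · obtain ⟨b₁, n₁, c₁, T, rfl, h1, h2, h3, -, -⟩ := hs.retirePost hP hr hI
        obtain ⟨orig', lab', b', n', e', c', A, h6, h7, h8, h9⟩ := ih h1
        refine ⟨orig', lab', b', n', e', c', T ∪ A, h6, ?_, ?_, ?_⟩
        · have := ArchRun.cons h2 h7
          simpa [numRetired, hr] using this
        · rw [h3, obsLabels_append, Set.union_assoc]
          intro l hl
          rcases hl with hl | hl
          · exact .inl (.inl hl)
          · rcases h8 hl with hl | hl
            · exact .inl (.inr hl)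
            · exact .inr (.inr hl)
        · simp only [numRetired, List.countP_cons, hf, hr] at h9 ⊢
          simp only [Bool.false_eq_true, if_false, if_true]
          omega
    · obtain ⟨⟨orig₁, lab₁, b₁, e₁, h1, h2, h3, h4, -⟩, rfl, hr⟩ := hs.fetchPost hf hI
      obtain ⟨orig', lab', b', n', e', c', A, h6, h7, h8, h9⟩ := ih h1
      refine ⟨orig', lab', b', n', e', c', A, h6, ?_, ?_, ?_⟩
      · rw [h2, h3] at h7
        simpa [numRetired, hr] using h7
      · rwa [h4] at h8
      · simp only [numRetired, List.countP_cons, hf, hr] at h9 ⊢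
        simp only [Bool.false_eq_true, if_false, if_true]
        omega

/-- An idle start has no pending labels, so all labels of the run were observed. At an idle end the
program point of the oldest instruction is the current one, which determines the final state. -/
theorem Exec.archRun (hP : P.NotRead M.rret) {D : List (Directive V)}
    {O : List (Obs V L)} (h : Exec M P C D O C') (hC : C.Idle) :
    ∃ A s, ArchRun M P C.state (numRetired D) A s ∧ A ⊆ obsLabels O ∧
      (C'.Idle → s = C'.state) := by
  obtain ⟨orig', lab', b', n', e', c', A, h1, h2, h3, -⟩ := h.archRun_of_inv hP (Inv.of_idle hC)
  rw [pendLabels_empty, Set.empty_union] at h3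
  refine ⟨A, _, h2, Set.subset_union_left.trans h3, fun h => ?_⟩
  rw [(h1.of_idle_eq h).2.1]
  rfl

/-- The number of instructions in flight is at most fetches minus retirements; rollbacks only lower
it. The criterion involves the schedule alone and so covers all executions of that schedule. -/
theorem Exec.idle_of_count (hP : P.NotRead M.rret) {D : List (Directive V)}
    {O : List (Obs V L)} (h : Exec M P C D O C') (hC : C.Idle)
    (hD : D.countP Directive.isFetch ≤ numRetired D) : C'.Idle := by
  obtain ⟨orig', lab', b', n', e', c', A, h1, -, -, h4⟩ := h.archRun_of_inv hP (Inv.of_idle hC)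
  obtain rfl : c' = 0 := by omega
  exact h1.idle

theorem IsSequential.tail {d : Directive V} {D : List (Directive V)} {O : List (Obs V L)}
    (h : IsSequential M P C (d :: D)) (hs : Step M P C d O C') : IsSequential M P C' D := by
  rintro D₁ D₂ d' O' C'' rfl hd hE
  exact h (d :: D₁) D₂ d' (O ++ O') C'' rfl hd (.cons hs hE)

/-- A sequential execution exposes only the labels of its architectural run. -/
theorem Exec.archRun_of_sequential (hP : P.NotRead M.rret) {D : List (Directive V)}
    {O : List (Obs V L)} (h : Exec M P C D O C') (hseq : IsSequential M P C D)
    (hI : Inv M P C orig lab b n e c) (hc : c ≤ 1) (hng : C.NoGuess) (hC' : C'.Idle) :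
    ∃ A s, ArchRun M P ⟨C.reg, C.mem, n⟩ (numRetired D) A s ∧
      pendLabels lab b e ∪ obsLabels O ⊆ A := by
  induction h generalizing orig lab b n e c with
  | nil C =>
    -- Terminality is used here: labels of entries still in flight would not belong to the run.
    refine ⟨∅, _, .nil _, ?_⟩
    rw [(hI.of_idle_eq hC').2.2, obsLabels_nil, Set.empty_union]
  | @cons C C₁ C₂ d D O O' hs _ ih =>
    have hseq' := hseq.tail hs
    rcases hf : d.isFetch with _ | _
    · rcases hr : d.isRetire with _ | _
      · obtain ⟨orig₁, lab₁, e₁, c₁, h1, h2, h3, h4, -, h5⟩ := hs.execPost hf hr hI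
        obtain ⟨rfl, h6, h7⟩ := h5 hc hng
        obtain ⟨A, s, h8, h9⟩ := ih hseq' h1 hc h6 hC'
        refine ⟨A, s, ?_, Set.Subset.trans ?_ h9⟩
        · rw [h2, h3] at h8
          simpa [numRetired, hr] using h8
        · rw [obsLabels_append, ← Set.union_assoc, Set.union_comm (pendLabels lab b e)]
          exact Set.union_subset_union_left _ h7
      · obtain ⟨b₁, n₁, c₁, T, rfl, h1, h2, h3, h4, h5⟩ := hs.retirePost hP hr hI
        obtain ⟨A, s, h6, h7⟩ := ih hseq' h1 (by omega) (h5 hng) hC'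
        refine ⟨T ∪ A, s, ?_, ?_⟩
        · have := ArchRun.cons h2 h6
          simpa [numRetired, hr] using this
        · rw [h3, obsLabels_append]
          rintro l ((hl | hl) | (hl | hl))
          · exact .inl hl
          · exact .inr (h7 (.inl hl))
          · exact .inl (h4 hl)
          · exact .inr (h7 (.inr hl))
    -- Sequentiality at the empty prefix. The count thus goes from `0` to `1` at a fetch and the
    -- bound `c ≤ 1` is maintained.
    · have hidle : C.Idle := hseq [] D d [] C rfl hf (.nil C)
      obtain ⟨rfl, -⟩ := hI.of_idle_eq hidle
      obtain ⟨⟨orig₁, lab₁, b₁, e₁, h1, h2, h3, h4, h5⟩, rfl, hr⟩ := hs.fetchPost hf hI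
      obtain ⟨A, s, h6, h7⟩ := ih hseq' h1 le_rfl (h5 hng) hC'
      refine ⟨A, s, ?_, ?_⟩
      · rw [h2, h3] at h6
        simpa [numRetired, hr] using h6
      · rwa [h4] at h7

theorem SeqExec.archRun (hP : P.NotRead M.rret) {D : List (Directive V)}
    {O : List (Obs V L)} (h : SeqExec M P C D O C') :
    ∃ A s, ArchRun M P C.state (numRetired D) A s ∧ obsLabels O ⊆ A := by
  obtain ⟨h1, h2, h3, h4⟩ := h
  obtain ⟨A, s, h5, h6⟩ := h3.archRun_of_sequential hP h2 (Inv.of_idle h1) zero_le_one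
    h1.noGuess h4
  exact ⟨A, s, h5, Set.subset_union_right.trans h6⟩

end

end

section

variable {R V L Op : Type*}

/-! ### Sequential schedules -/

/-- A directive that executes a buffer entry. -/
def Directive.IsExec (d : Directive V) : Prop := d.isFetch = false ∧ d.isRetire = false

/-- The reorder buffer consists of the entry `t` at index `1`. -/
def Config.Single (C : Config R V L Op) (t : Transient R V L Op) : Prop :=
  ∀ k, C.buf.get k = if k = 1 then some t else none

namespace Config.Single

variable {C : Config R V L Op} {t t' : Transient R V L Op}

theorem setBuf (h : C.Single t) : (C.setBuf 1 t').Single t' := by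
  intro k
  simp only [Config.setBuf, FMap.get_set]
  split_ifs with hk
  · rfl
  · rw [h, if_neg hk]

theorem get (h : C.Single t) : C.buf.get 1 = some t := by rw [h, if_pos rfl]

theorem get_lt (h : C.Single t) {k : ℕ} (hk : k < 1) : C.buf.get k = none := by
  rw [h, if_neg (by omega)]

theorem noFence (h : C.Single t) : C.NoFence 1 := by
  intro j hj
  rw [h.get_lt hj]
  simp

theorem not_storeAt (h : C.Single t) {k : ℕ} (hk : k < 1) (a : V) : ¬ C.StoreAt k a := by
  rintro ⟨src, b, hs, -⟩
  rw [h.get_lt hk] at hs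
  cases hs

theorem not_hazard (h : C.Single t) (a : V) (k : ℕ) : ¬ C.Hazard 1 a k := by
  rintro ⟨hk, r, v, dep, b, pt, hg, -⟩
  rw [h, if_neg (by omega)] at hg
  cases hg

theorem resolveReg (h : C.Single t) : C.resolveReg 1 = C.reg :=
  Config.resolveReg_eq_reg fun _ hj => h.get_lt hj

theorem retirable (h : C.Single t) : C.Retirable 1 :=
  FMap.minIdx_eq (by simp [h.get]) fun k hk => by
    by_contra hk'
    exact hk (h.get_lt (by omega))

theorem erase (h : C.Single t) : C.buf.erase 1 = FMap.empty := by
  refine FMap.ext_get fun k => ?_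
  rw [FMap.get_erase, h]
  split_ifs <;> simp_all

end Config.Single

theorem Config.Idle.fresh_eq {C : Config R V L Op} (hC : C.Idle) : C.fresh = 1 := by
  rw [Config.fresh, hC, FMap.maxIdx_empty]

theorem Config.Idle.single {C : Config R V L Op} (hC : C.Idle) (t : Transient R V L Op)
    (m : V) :
    Config.Single { C.setBuf C.fresh t with pc := m } t := by
  intro k
  change (C.buf.set C.fresh t).get k = _
  rw [hC.fresh_eq, FMap.get_set, hC]
  rfl

/-! ### Completing one fetched instruction in isolation. -/

section

variable [DecidableEq R] [DecidableEq V] [Lattice L] [OrderBot L]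
  {M : Machine R V Op} {P : Program R V L Op} {C : Config R V L Op}

/-- From `C`, some executions of buffer entries and a retirement lead to an idle configuration. -/
def Completes (M : Machine R V Op) (P : Program R V L Op) (C : Config R V L Op) : Prop :=
  ∃ (D : List (Directive V)) (O : List (Obs V L)) (C' : Config R V L Op),
    Exec M P C (D ++ [.retire]) O C' ∧ C'.Idle ∧ ∀ d ∈ D, d.IsExec

theorem Completes.of_retire {C' : Config R V L Op} {O : List (Obs V L)}
    (h : Step M P C .retire O C') (hC : C'.Idle) : Completes M P C :=
  ⟨[], _, C', .cons h (.nil _), hC, by simp⟩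

theorem Completes.of_exec {C' : Config R V L Op} {d : Directive V} {O : List (Obs V L)}
    (h : Step M P C d O C') (hd : d.IsExec) (hC : Completes M P C') : Completes M P C := by
  obtain ⟨D, O', C'', h1, h2, h3⟩ := hC
  refine ⟨d :: D, _, C'', .cons h h1, h2, ?_⟩
  simpa using ⟨hd, h3⟩

theorem Config.Single.completes_value {t : Transient R V L Op} {r : R} {v : LVal V L}
    (h : C.Single t) (ht : t.IsValue r v) :
    Completes M P C :=
  .of_retire (.value_retire 1 t r v h.retirable h.get ht) h.erase

theorem Config.Single.completes_jump {m : V} (h : C.Single (.jump m)) : Completes M P C :=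
  .of_retire (.jump_retire 1 m h.retirable h.get) h.erase

/-- A fetched call can be executed and retired. -/
theorem Completes.call {a v : LVal V L} {vs : List (LVal V L)} {x : V}
    (hbuf : ∀ k, C.buf.get k = if k = 1 then some .call
      else if k = 2 then some (.op M.rsp M.succ [.reg M.rsp])
      else if k = 3 then some (.store (.val v) (.inl [.reg M.rsp])) else none)
    (hvs : EvalArgs C.reg [.reg M.rsp] vs) (hv : M.evalOp M.succ (vs.map LVal.val) = some x)
    (ha : EvalAddr M (Function.update C.reg M.rsp (some ⟨x, joinLab vs⟩)) [.reg M.rsp] a) :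
    Completes M P C := by
  have hr1 : C.resolveReg 1 = C.reg := Config.resolveReg_eq_reg fun j hj => by
    obtain rfl : j = 0 := by omega
    simp [hbuf]
  have hr2 : C.resolveReg 2 = C.reg := by
    rw [Config.resolveReg_succ_no_target (i := 1) (t := .call) (by simp [hbuf]) rfl, hr1]
  refine .of_exec (d := .exec 2) (.op_execute 2 M.rsp M.succ [.reg M.rsp] vs x (by simp [hbuf])
    ?_ ((Config.resolves_iff _ _ _ _).2 (by rwa [hr2])) hv) ⟨rfl, rfl⟩ ?_
  · intro j hj
    rw [hbuf]
    split_ifs <;> simp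
  set C₂ := C.setBuf 2 (.value M.rsp ⟨x, joinLab vs⟩) with hC₂
  have hbuf₂ : ∀ k, C₂.buf.get k = if k = 1 then some .call
      else if k = 2 then some (.value M.rsp ⟨x, joinLab vs⟩)
      else if k = 3 then some (.store (.val v) (.inl [.reg M.rsp])) else none := by
    intro k
    simp only [hC₂, Config.setBuf, FMap.get_set, hbuf]
    split_ifs <;> simp_all
  have hs1 : C₂.resolveReg 1 = C.reg := Config.resolveReg_eq_reg fun j hj => by
    obtain rfl : j = 0 := by omega
    simp [hbuf₂]
  have hs3 : C₂.resolveReg 3 = Function.update C.reg M.rsp (some ⟨x, joinLab vs⟩) := by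
    rw [Config.resolveReg_succ_target (i := 2) (t := .value M.rsp ⟨x, joinLab vs⟩)
      (by simp [hbuf₂]) rfl, Config.resolveReg_succ_no_target (i := 1) (t := .call)
      (by simp [hbuf₂]) rfl, hs1]
    rfl
  refine .of_exec (d := .execAddr 3) (.store_execute_addr_ok 3 (.val v) [.reg M.rsp] a
    (by simp [hbuf₂]) ?_ ((Config.resolvesAddr_iff _ _ _ _ _).2 (by rwa [hs3])) ?_) ⟨rfl, rfl⟩ ?_
  · intro j hj
    rw [hbuf₂]
    split_ifs <;> simp
  · rintro k ⟨hk, r, w, dep, b, pt, hg, -⟩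
    rw [hbuf₂] at hg
    split_ifs at hg <;> cases hg
  refine .of_retire (.call_retire 1 ⟨x, joinLab vs⟩ v a (FMap.minIdx_eq ?_ ?_) ?_ ?_ ?_) ?_
  · simp [Config.setBuf, FMap.get_set, hbuf₂]
  · intro k hk
    by_contra hk'
    obtain rfl : k = 0 := by omega
    simp [Config.setBuf, FMap.get_set, hbuf₂] at hk
  · simp [Config.setBuf, FMap.get_set, hbuf₂]
  · simp [Config.setBuf, FMap.get_set, hbuf₂]
  · simp [Config.setBuf]
  · refine FMap.ext_get fun k => ?_
    simp only [Config.setBuf, FMap.get_above, FMap.get_set, hbuf₂, FMap.get_empty]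
    split_ifs <;> first | rfl | omega

/-- A fetched return can be executed and retired. -/
theorem Completes.ret {a w m : LVal V L} {vs : List (LVal V L)} {x g pt : V}
    (hbuf : ∀ k, C.buf.get k = if k = 1 then some .ret
      else if k = 2 then some (.load M.rret [.reg M.rsp] pt)
      else if k = 3 then some (.op M.rsp M.pred [.reg M.rsp])
      else if k = 4 then some (.jmpi [.reg M.rret] g) else none)
    (ha : EvalAddr M C.reg [.reg M.rsp] a) (hw : C.mem a.val = some w)
    (hvs : EvalArgs C.reg [.reg M.rsp] vs) (hv : M.evalOp M.pred (vs.map LVal.val) = some x)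
    (hm : EvalAddr M (Function.update C.reg M.rret (some w)) [.reg M.rret] m) :
    Completes M P C := by
  have hne := M.rret_ne_rsp
  have hr1 : C.resolveReg 1 = C.reg := Config.resolveReg_eq_reg fun j hj => by
    obtain rfl : j = 0 := by omega
    simp [hbuf]
  have hr2 : C.resolveReg 2 = C.reg := by
    rw [Config.resolveReg_succ_no_target (i := 1) (t := .ret) (by simp [hbuf]) rfl, hr1]
  refine .of_exec (d := .exec 2) (.load_execute_nodep 2 M.rret [.reg M.rsp] pt a w (by simp [hbuf])
    ?_ ((Config.resolvesAddr_iff _ _ _ _ _).2 (by rwa [hr2])) ?_ hw) ⟨rfl, rfl⟩ ?_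
  · intro j hj
    rw [hbuf]
    split_ifs <;> simp
  · rintro k hk ⟨src, b, hs, -⟩
    rw [hbuf] at hs
    split_ifs at hs <;> cases hs
  set C₂ := C.setBuf 2 (.loaded M.rret w ⊥ a.val pt) with hC₂
  have hbuf₂ : ∀ k, C₂.buf.get k = if k = 1 then some .ret
      else if k = 2 then some (.loaded M.rret w ⊥ a.val pt)
      else if k = 3 then some (.op M.rsp M.pred [.reg M.rsp])
      else if k = 4 then some (.jmpi [.reg M.rret] g) else none := by
    intro k
    simp only [hC₂, Config.setBuf, FMap.get_set, hbuf]
    split_ifs <;> simp_all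
  have hs1 : C₂.resolveReg 1 = C.reg := Config.resolveReg_eq_reg fun j hj => by
    obtain rfl : j = 0 := by omega
    simp [hbuf₂]
  have hs3 : C₂.resolveReg 3 = Function.update C.reg M.rret (some w) := by
    rw [Config.resolveReg_succ_target (i := 2) (t := .loaded M.rret w ⊥ a.val pt)
      (by simp [hbuf₂]) rfl, Config.resolveReg_succ_no_target (i := 1) (t := .ret)
      (by simp [hbuf₂]) rfl, hs1]
    rfl
  refine .of_exec (d := .exec 3) (.op_execute 3 M.rsp M.pred [.reg M.rsp] vs x (by simp [hbuf₂])
    ?_ ((Config.resolves_iff _ _ _ _).2 (hvs.mono fun r hr v hv => ?_)) hv) ⟨rfl, rfl⟩ ?_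
  · intro j hj
    rw [hbuf₂]
    split_ifs <;> simp
  · obtain rfl : r = M.rsp := by simpa using hr
    rwa [hs3, Function.update_of_ne hne.symm]
  set C₃ := C₂.setBuf 3 (.value M.rsp ⟨x, joinLab vs⟩) with hC₃
  have hbuf₃ : ∀ k, C₃.buf.get k = if k = 1 then some .ret
      else if k = 2 then some (.loaded M.rret w ⊥ a.val pt)
      else if k = 3 then some (.value M.rsp ⟨x, joinLab vs⟩)
      else if k = 4 then some (.jmpi [.reg M.rret] g) else none := by
    intro k
    simp only [hC₃, Config.setBuf, FMap.get_set, hbuf₂]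
    split_ifs <;> simp_all
  have hu3 : C₃.resolveReg 3 = Function.update C.reg M.rret (some w) :=
    (Config.resolveReg_congr (C := C₂) (C' := C₃) rfl fun j hj =>
      FMap.get_set_of_ne _ _ (by omega)).trans hs3
  have hm' : C₃.ResolvesAddr M 4 [.reg M.rret] m := by
    refine (Config.resolvesAddr_iff _ _ _ _ _).2 (hm.mono fun r hr v hv => ?_)
    obtain rfl : r = M.rret := by simpa using hr
    rwa [Config.resolveReg_succ_target (i := 3) (t := .value M.rsp ⟨x, joinLab vs⟩)
      (by simp [hbuf₃]) rfl, hu3, Function.update_of_ne hne]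
  have hf : C₃.NoFence 4 := by
    intro j hj
    rw [hbuf₃]
    split_ifs <;> simp
  have hlast : ∀ C₄ : Config R V L Op, (∀ k, C₄.buf.get k = if k = 1 then some .ret
      else if k = 2 then some (.loaded M.rret w ⊥ a.val pt)
      else if k = 3 then some (.value M.rsp ⟨x, joinLab vs⟩)
      else if k = 4 then some (.jump m.val) else none) → Completes M P C₄ := by
    intro C₄ hbuf₄
    refine .of_retire (.ret_retire 1 (.loaded M.rret w ⊥ a.val pt) (.value M.rsp ⟨x, joinLab vs⟩)
      w ⟨x, joinLab vs⟩ m.val (FMap.minIdx_eq ?_ ?_) ?_ ?_ (.loaded _ _ _ _ _) ?_ (.value _ _)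
      ?_) ?_
    · simp [hbuf₄]
    · intro k hk
      by_contra hk'
      obtain rfl : k = 0 := by omega
      simp [hbuf₄] at hk
    · simp [hbuf₄]
    · simp [hbuf₄]
    · simp [hbuf₄]
    · simp [hbuf₄]
    · refine FMap.ext_get fun k => ?_
      simp only [FMap.get_above, hbuf₄, FMap.get_empty]
      split_ifs <;> first | rfl | omega
  -- The return stack buffer may mispredict even in order. The jump is the last entry, so correcting
  -- it leaves the same buffer as a right guess.
  by_cases hg : m.val = g
  · refine .of_exec (d := .exec 4) (.jmpi_execute_correct 4 [.reg M.rret] g m (by simp [hbuf₃])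
      hf hm' hg) ⟨rfl, rfl⟩ (hlast _ fun k => ?_)
    simp only [Config.setBuf, FMap.get_set, hbuf₃, hg]
    split_ifs <;> simp_all
  · refine .of_exec (d := .exec 4) (.jmpi_execute_incorrect 4 [.reg M.rret] g m (by simp [hbuf₃])
      hf hm' hg) ⟨rfl, rfl⟩ (hlast _ fun k => ?_)
    simp only [Config.setBuf, Config.rollback, FMap.get_set, FMap.get_below, hbuf₃]
    split_ifs <;> first | rfl | omega

/-- Every architectural step is performed by fetching, executing and retiring an instruction. -/
theorem ArchStep.completes {T : Set L} {s : ArchState R V L} (h : ArchStep M P C.state T s)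
    (hC : C.Idle) : ∃ d C', Step M P C d [] C' ∧ d.isFetch = true ∧ d.isRetire = false ∧
      Completes M P C' := by
  cases h with
  | @op o r args next vs v hP hvs hv =>
    have h1 := hC.single (.op r o args) next
    refine ⟨_, _, .op_fetch o r args next hP, rfl, rfl, .of_exec (.op_execute 1 r o args vs v h1.get
      h1.noFence ((Config.resolves_iff _ _ _ _).2 ?_) hv) ⟨rfl, rfl⟩
      (h1.setBuf.completes_value (.value _ _))⟩
    rw [h1.resolveReg]
    exact hvs
  | @br o args nT nF vs c hP hvs hc =>
    -- The guess is taken to be the actual outcome, so no correction is needed; the indirect jump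
    -- below is handled likewise.
    have h1 := hC.single (.br o args (if c then nT else nF) nT nF) (if c then nT else nF)
    refine ⟨_, _, .br_fetch c o args nT nF hP, rfl, rfl, .of_exec (.br_execute_correct 1 o args
      _ nT nF vs c h1.get h1.noFence ((Config.resolves_iff _ _ _ _).2 ?_) hc rfl) ⟨rfl, rfl⟩
      h1.setBuf.completes_jump⟩
    rw [h1.resolveReg]
    exact hvs
  | @load r args next a v hP ha hv =>
    have h1 := hC.single (.load r args C.pc) next
    refine ⟨_, _, .load_fetch r args next hP, rfl, rfl, .of_exec (.load_execute_nodep 1 r args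
      C.pc a v h1.get h1.noFence ((Config.resolvesAddr_iff _ _ _ _ _).2 ?_)
      (fun k hk => h1.not_storeAt hk _) hv) ⟨rfl, rfl⟩
      (h1.setBuf.completes_value (.loaded _ _ _ _ _))⟩
    rw [h1.resolveReg]
    exact ha
  | @store src args next a v hP ha hv =>
    have h1 := hC.single (.store src (.inl args)) next
    have h2 := h1.setBuf (t' := .store src (.inr a))
    refine ⟨_, _, .store_fetch src args next hP, rfl, rfl, .of_exec (.store_execute_addr_ok 1 src
      args a h1.get h1.noFence ((Config.resolvesAddr_iff _ _ _ _ _).2 ?_) (h1.not_hazard _))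
      ⟨rfl, rfl⟩ (.of_exec (.store_execute_value 1 src (.inr a) v h2.get h2.noFence ?_) ⟨rfl, rfl⟩
      (.of_retire (.store_retire 1 v a h2.setBuf.retirable h2.setBuf.get) h2.setBuf.erase))⟩
    · rw [h1.resolveReg]
      exact ha
    · rw [Config.resolve_eq, h2.resolveReg]
      exact hv
  | @jmpi args a hP ha =>
    have h1 := hC.single (.jmpi args a.val) a.val
    refine ⟨_, _, .jmpi_fetch a.val args hP, rfl, rfl, .of_exec (.jmpi_execute_correct 1 args a.val
      a h1.get h1.noFence ((Config.resolvesAddr_iff _ _ _ _ _).2 ?_) rfl) ⟨rfl, rfl⟩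
      h1.setBuf.completes_jump⟩
    rw [h1.resolveReg]
    exact ha
  | @call nf nret vs v a hP hvs hv ha =>
    refine ⟨_, _, .call_fetch nf nret hP, rfl, rfl, .call (v := ⟨nret, ⊥⟩) ?_ hvs hv ha⟩
    intro k
    simp only [hC.fresh_eq, FMap.get_set, show C.buf = FMap.empty from hC, FMap.get_empty]
    split_ifs <;> first | rfl | omega
  | @ret vs v a w m hP ha hw hvs hv hm =>
    have hret : ∀ g, Completes M P (C.fetchRet M g) := by
      intro g
      refine .ret (g := g) (pt := C.pc) ?_ ha hw hvs hv hm
      intro k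
      simp only [Config.fetchRet, hC.fresh_eq, FMap.get_set, show C.buf = FMap.empty from hC,
        FMap.get_empty]
      split_ifs <;> first | rfl | omega
    rcases htop : rsbTop C.rsb with _ | g
    -- Any guess would do, since the jump corrects it; `C.pc` is merely an available program point.
    · exact ⟨_, _, .ret_fetch_rsb_empty C.pc hP htop, rfl, rfl, hret _⟩
    · exact ⟨_, _, .ret_fetch_rsb g hP htop, rfl, rfl, hret _⟩
  | @fence next hP =>
    have h1 := hC.single .fence next
    exact ⟨_, _, .fence_fetch next hP, rfl, rfl,
      .of_retire (.fence_retire 1 h1.retirable h1.get) h1.erase⟩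

end

/-- In front of every fetch, as many instructions have been retired as have been fetched. -/
def Alternating (D : List (Directive V)) : Prop :=
  ∀ D₁ d D₂, D = D₁ ++ d :: D₂ → d.isFetch = true → D₁.countP Directive.isFetch ≤ numRetired D₁

theorem Directive.IsExec.count {D : List (Directive V)} (h : ∀ d ∈ D, d.IsExec) :
    D.countP Directive.isFetch = 0 ∧ numRetired D = 0 := by
  constructor
  · rw [List.countP_eq_zero]
    exact fun d hd => by simp [(h d hd).1]
  · rw [numRetired, List.countP_eq_zero]
    exact fun d hd => by simp [(h d hd).2]

/-- The block retires at least as many instructions as it fetches, so positions after it inherit the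
condition from `D`. Inside the block only the first directive can be a fetch, with an empty prefix.
-/
theorem Alternating.cons {d : Directive V} {X D : List (Directive V)}
    (hX : ∀ d ∈ X, d.IsExec) (hD : Alternating D) :
    Alternating (d :: (X ++ [.retire]) ++ D) := by
  obtain ⟨h1, h2⟩ := Directive.IsExec.count hX
  have hblock : (d :: (X ++ [Directive.retire])).countP Directive.isFetch ≤
      numRetired (d :: (X ++ [.retire])) := by
    simp only [numRetired] at h2
    simp only [numRetired, List.countP_cons, List.countP_append, List.countP_nil, h1, h2]
    simp only [Directive.isFetch, Directive.isRetire]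
    split_ifs <;> simp_all
  intro D₁ d' D₂ h hf
  rcases List.append_eq_append_iff.1 h with ⟨E, rfl, hE⟩ | ⟨E, hE, hE'⟩
  · have := hD E d' D₂ hE hf
    simp only [numRetired] at this hblock ⊢
    rw [List.countP_append, List.countP_append]
    omega
  · cases D₁ with
    | nil => simp
    | cons d₁ D₁ =>
      cases E with
      | nil =>
        rw [List.append_nil] at hE
        rw [← hE]
        exact hblock
      | cons d₂ E =>
        obtain ⟨rfl, -⟩ := List.cons.inj hE'
        obtain ⟨-, hE⟩ := List.cons.inj hE
        have hmem : d' ∈ X ++ [Directive.retire] := by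
          rw [hE]
          simp
        rcases List.mem_append.1 hmem with h' | h'
        · rw [(hX d' h').1] at hf
          cases hf
        · obtain rfl := List.mem_singleton.1 h'
          cases hf

/-! ### Realising architectural runs by sequential executions. -/

section

variable [DecidableEq R] [DecidableEq V] [Lattice L] [OrderBot L]
  {M : Machine R V Op} {P : Program R V L Op} {C C' C'' : Config R V L Op}

theorem Exec.append {D D' : List (Directive V)} {O O' : List (Obs V L)} (h : Exec M P C D O C')
    (h' : Exec M P C' D' O' C'') : Exec M P C (D ++ D') (O ++ O') C'' := by
  induction h with
  | nil => exact h'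
  | cons hs _ ih =>
    rw [List.append_assoc]
    exact .cons hs (ih h')

/-- `IsSequential` quantifies over all executions of a prefix; the counting criterion handles them
without following any of them. -/
theorem Alternating.isSequential (hP : P.NotRead M.rret) (hC : C.Idle) {D : List (Directive V)}
    (hD : Alternating D) : IsSequential M P C D :=
  fun D₁ D₂ d _ _ h hd hE => hE.idle_of_count hP hC (hD D₁ d D₂ h hd)

/-- Every architectural run is performed by a sequential execution. -/
theorem ArchRun.exists_seqExec (hP : P.NotRead M.rret) {s s' : ArchState R V L} {k : ℕ}
    {A : Set L} (h : ArchRun M P s k A s') (hC : C.Idle) (hs : C.state = s) :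
    ∃ (D : List (Directive V)) (O : List (Obs V L)) (C' : Config R V L Op),
      SeqExec M P C D O C' ∧ numRetired D = k := by
  suffices h : ∃ (D : List (Directive V)) (O : List (Obs V L)) (C' : Config R V L Op),
      Exec M P C D O C' ∧ C'.Idle ∧ Alternating D ∧ numRetired D = k by
    obtain ⟨D, O, C', h1, h2, h3, h4⟩ := h
    exact ⟨D, O, C', ⟨hC, h3.isSequential hP hC, h1, h2⟩, h4⟩
  induction h generalizing C with
  | nil s =>
    exact ⟨[], [], C, .nil C, hC, fun D₁ d D₂ h => by simp at h, rfl⟩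
  | cons hstep _ ih =>
    subst hs
    obtain ⟨d, C₁, h1, -, h2, X, O, C₂, h3, h4, h5⟩ := hstep.completes hC
    have hE := Exec.cons h1 h3
    have hn : numRetired (d :: (X ++ [.retire])) = 1 := by
      have := (Directive.IsExec.count h5).2
      simp only [numRetired] at this
      simp [numRetired, List.countP_append, this, h2,
        show (Directive.retire : Directive V).isRetire = true from rfl]
    -- The construction of the block does not record its final state. The simulation gives an
    -- architectural run of length one, and determinism identifies its end with the intended state.
    obtain ⟨A', s'', h6, -, h7⟩ := hE.archRun hP hC
    rw [hn] at h6
    cases h6 with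
    | cons hstep' hrun =>
    cases hrun with
    | nil =>
    obtain ⟨-, rfl⟩ := hstep.functional hstep'
    obtain ⟨D, O', C₃, h8, h9, h10, h11⟩ := ih h4 (h7 h4).symm
    refine ⟨_, _, C₃, hE.append h8, h9, h10.cons h5, ?_⟩
    simp only [numRetired] at hn h11 ⊢
    rw [List.countP_append, hn, h11, Nat.add_comm]

end

end

end Spec


theorem mainTheorem2 {R V L Op : Type*} [DecidableEq R] [DecidableEq V] [Lattice L] [OrderBot L]
    (M : Spec.Machine R V Op) (P : Spec.Program R V L Op) (hP : P.NotRead M.rret)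
    (ℓ : L)
    (C : Spec.Config R V L Op) (hC : C.Idle)
    (D₁ : List (Spec.Directive V)) (O₁ : List (Spec.Obs V L)) (C₁ : Spec.Config R V L Op)
    (hexec : Spec.Exec M P C D₁ O₁ C₁)
    (hO₁ : ∀ o ∈ O₁, ¬ o.Carries ℓ) :
    (∃ (D₂ : List (Spec.Directive V)) (O₂ : List (Spec.Obs V L)) (C₂ : Spec.Config R V L Op),
      Spec.SeqExec M P C D₂ O₂ C₂ ∧ Spec.numRetired D₂ = Spec.numRetired D₁ ∧
        ∀ o ∈ O₂, ¬ o.Carries ℓ) ∧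
    (∀ (D₂ : List (Spec.Directive V)) (O₂ : List (Spec.Obs V L)) (C₂ : Spec.Config R V L Op),
      Spec.SeqExec M P C D₂ O₂ C₂ → Spec.numRetired D₂ ≤ Spec.numRetired D₁ →
        ∀ o ∈ O₂, ¬ o.Carries ℓ) := by
  obtain ⟨A, s, hrun, hA, -⟩ := hexec.archRun hP hC
  have hsecret : ∀ (D₂ : List (Spec.Directive V)) (O₂ : List (Spec.Obs V L))
      (C₂ : Spec.Config R V L Op), Spec.SeqExec M P C D₂ O₂ C₂ →
      Spec.numRetired D₂ ≤ Spec.numRetired D₁ → ∀ o ∈ O₂, ¬ o.Carries ℓ := by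
    intro D₂ O₂ C₂ hseq hn o ho hl
    obtain ⟨A₂, s₂, hrun₂, hA₂⟩ := hseq.archRun hP
    -- A label of the sequential trace belongs to its own run, hence to the longer run `A`, hence to
    -- the speculative trace.
    obtain ⟨o', ho', hl'⟩ := hA (hrun₂.labels_subset hrun hn (hA₂ ⟨o, ho, hl⟩))
    exact hO₁ o' ho' hl'
  obtain ⟨D₂, O₂, C₂, hseq, hn⟩ := hrun.exists_seqExec hP hC rfl
  exact ⟨⟨D₂, O₂, C₂, hseq, hn, hsecret D₂ O₂ C₂ hseq hn.le⟩, hsecret⟩
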